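/- Throughout, $AP=\{0,\dots,n-1\}$ is a finite set of atomic propositions and $\Sigma_{AP}=2^{AP}$. A timed word (trace) is a finite sequence of events $(\sigma_i,\tau_i)\in\Sigma_{AP}\times\mathbb R_{\ge 0}$ with strictly increasing timestamps. HyperMTL formulae are $\phi ::= \exists\pi\,\phi\mid\forall\pi\,\phi\mid\psi$ with quantifier-free part $\psi ::= \top\mid\top_\pi\mid p_\pi\mid\psi_1\wedge\psi_2\mid\neg\psi\mid\psi_1\mathbf U_I\psi_2\mid\psi_1\mathbf S_I\psi_2$, where $p\in AP$, each quantifier uses a fresh trace variable $\pi$, and $I\subseteq\mathbb R_{\ge0}$ is a non-singular interval with endpoints in $\mathbb N\cup\{\infty\}$. The quantifier-free part has the pointwise semantics: $\mathbf U_I$ and $\mathbf S_I$ are strict and range over times at which some assigned trace has an event; $\top$ (respectively $\top_\pi$) holds at $t$ iff some assigned trace (respectively the trace of $\pi$) has an event at $t$; $p_\pi$ holds at $t$ iff the trace of $\pi$ has an event at $t$ whose letter contains $p$; a negation is evaluated in negation normal form, where $\neg p_\pi$ also requires the trace of $\pi$ to have an event at $t$. In the synchronous semantics each trace quantifier ranges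 over those traces of the given trace set that have exactly the same timestamps as all the traces already assigned; satisfaction is evaluated at time $0$ and written $T\models^{\mathit{sync}}\phi$. A metric interval automaton (MIA) is a timed automaton with a single clock, in which no guard (a conjunction of constraints $x\bowtie c$ with ${\bowtie}\in\{\le,<,\ge,>\}$, $c\in\mathbb N$) is satisfied by exactly one clock value, and every transition whose guard is not $\top$ resets the clock. For a closed formula $\phi$ with trace variables $\pi_1,\dots,\pi_k$, its quantifier-free part $\psi$ translates into an MIA $\mathcal B$ over $2^{\{p_{\pi_i}\mid p\in AP,\,1\le i\le k\}}$ if $\mathcal B$ accepts exactly those timed words over this alphabet whose $k$ components, as an assignment to $\pi_1,\dots,\pi_k$, satisfy $\psi$ at time $0$. **Proposition.** The following problem is undecidable: given $n$, an untimed automaton (a timed automaton without clocks, i.e. a finite automaton) $\mathcal A$ over $\Sigma_{AP}$ and a closed $\exists^*\forall^*$-HyperMTL formula $\phi=\exists\pi_1\dots\forall\pi_k\,\psi$ over $AP$ such that $\psi$ (itself, rather than $\neg\psi$) translates into an MIA, does $[\![\mathcal A]\!]\models^{\mathit{sync}}\phi$ hold, where $[\![\mathcal A]\!]$ is the set of timed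 words accepted by $\mathcal A$? It is undecidable already for formulae of the form $\exists\pi_a\forall\pi_b\forall\pi_c\,\psi$, and remains so even if an MIA into which $\psi$ translates is given as part of the input. Here undecidable means that no partial recursive function halts with the correct answer on (the code of) every input satisfying the stated conditions, whatever it does on other inputs. -/

import Mathlib

open scoped NNReal

namespace HyperMTL

/-! ### Timed words -/

/-- A timed word over the alphabet of finite subsets of `P`: a finite sequence of events with
strictly increasing timestamps. -/
@[ext]
structure TimedWord (P : Type) where
  events : List (Finset P × ℝ≥0)
  increasing : (events.map Prod.snd).Pairwise (· < ·)

/-- `t ∈ ρ`: some event of `ρ` happens at time `t`. -/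
def TimedWord.OccursAt {P : Type} (ρ : TimedWord P) (t : ℝ≥0) : Prop :=
  ∃ σ, (σ, t) ∈ ρ.events

/-- All letters of `ρ` are subsets of `D`. -/
def TimedWord.Over {P : Type} (ρ : TimedWord P) (D : Set P) : Prop :=
  ∀ e ∈ ρ.events, ∀ p ∈ e.1, p ∈ D

/-! ### Timed automata -/

/-- The comparisons allowed in clock constraints. -/
inductive Cmp
  | le | lt | ge | gt

def Cmp.Holds : Cmp → ℝ≥0 → ℝ≥0 → Prop
  | le, a, b => a ≤ b
  | lt, a, b => a < b
  | ge, a, b => a ≥ b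
  | gt, a, b => a > b

/-- An atomic clock constraint `x ⋈ c` (clocks are numbered). -/
structure ClockAtom where
  clock : ℕ
  cmp : Cmp
  const : ℕ

/-- A guard is a finite conjunction of atomic clock constraints; the empty conjunction is `⊤`. -/
abbrev Guard := List ClockAtom

def Guard.Holds (g : Guard) (v : ℕ → ℝ≥0) : Prop :=
  ∀ a ∈ g, a.cmp.Holds (v a.clock) (a.const : ℝ≥0)

/-- A transition. The letter read is the finite set of the members of the list `letter`; the set
of clocks reset to `0` is the set of members of `reset`. -/
structure Transition (P : Type) where
  src : ℕ
  letter : List P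
  guard : Guard
  reset : List ℕ
  dst : ℕ

/-- A finite presentation of a timed automaton: the locations are the numbers below `locs`, the
clocks are the numbers below `clocks`, letters are finite subsets of `P`. -/
structure TA (P : Type) where
  locs : ℕ
  init : ℕ
  clocks : ℕ
  trans : List (Transition P)
  acc : List ℕ

namespace TA

variable {P : Type}

/-- `A` is a timed automaton over the alphabet of subsets of `D`: all the locations, clocks and
propositions that it mentions exist. -/
structure WellFormed (A : TA P) (D : Set P) : Prop where
  init_lt : A.init < A.locs
  acc_lt : ∀ s ∈ A.acc, s < A.locs
  src_lt : ∀ e ∈ A.trans, e.src < A.locs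
  dst_lt : ∀ e ∈ A.trans, e.dst < A.locs
  letter_mem : ∀ e ∈ A.trans, ∀ p ∈ e.letter, p ∈ D
  guard_lt : ∀ e ∈ A.trans, ∀ a ∈ e.guard, a.clock < A.clocks
  reset_lt : ∀ e ∈ A.trans, ∀ x ∈ e.reset, x < A.clocks

/-- `A.Run s v τ w s' v'`: started in the state `(s, v)` at time `τ`, the automaton can read the
sequence of events `w` and end in the state `(s', v')`. -/
inductive Run (A : TA P) :
    ℕ → (ℕ → ℝ≥0) → ℝ≥0 → List (Finset P × ℝ≥0) → ℕ → (ℕ → ℝ≥0) → Prop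
  | nil (s : ℕ) (v : ℕ → ℝ≥0) (τ : ℝ≥0) : Run A s v τ [] s v
  | cons (e : Transition P) (v v₁ v' : ℕ → ℝ≥0) (τ τ₁ : ℝ≥0) (σ : Finset P)
      (w : List (Finset P × ℝ≥0)) (s' : ℕ)
      (mem : e ∈ A.trans)
      (reads : ∀ p, p ∈ σ ↔ p ∈ e.letter)
      (enabled : e.guard.Holds (fun x => v x + (τ₁ - τ)))
      (resets : ∀ x, v₁ x = if x ∈ e.reset then 0 else v x + (τ₁ - τ))
      (rest : Run A e.dst v₁ τ₁ w s' v') :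
      Run A e.src v τ ((σ, τ₁) :: w) s' v'

/-- The timed word `ρ` is accepted by `A`. -/
def Accepts (A : TA P) (ρ : TimedWord P) : Prop :=
  ∃ s v, s ∈ A.acc ∧ A.Run A.init (fun _ => 0) 0 ρ.events s v

/-- The timed language of `A`. -/
def language (A : TA P) : Set (TimedWord P) := {ρ | A.Accepts ρ}

/-- An untimed automaton: it has no clocks, i.e. it is a finite automaton. -/
def Untimed (A : TA P) : Prop := A.clocks = 0

/-- Non-singularity (NS): no guard of this one-clock automaton is satisfied by exactly one value
of the clock. -/
def NonSingular (A : TA P) : Prop :=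
  ∀ e ∈ A.trans, ¬ ∃ r : ℝ≥0, ∀ x : ℝ≥0, e.guard.Holds (fun _ => x) ↔ x = r

/-- Reset-on-testing (RoT): a transition of this one-clock automaton whose guard is not `⊤`
resets the clock. -/
def ResetOnTesting (A : TA P) : Prop :=
  ∀ e ∈ A.trans, e.guard ≠ [] → 0 ∈ e.reset

/-- `A` is a metric interval automaton over the alphabet of subsets of `D`. -/
structure IsMIA (A : TA P) (D : Set P) : Prop where
  wellFormed : A.WellFormed D
  oneClock : A.clocks = 1
  nonSingular : A.NonSingular
  resetOnTesting : A.ResetOnTesting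

end TA

/-! ### HyperMTL formulae -/

/-- A non-singular interval with endpoints in `ℕ ∪ {∞}`; `hi = none` stands for `∞`. -/
structure Interval where
  lo : ℕ
  hi : Option ℕ
  loClosed : Bool
  hiClosed : Bool
  nonsingular : ∀ b, hi = some b → lo < b

def Interval.Mem (I : Interval) (r : ℝ) : Prop :=
  (if I.loClosed then (I.lo : ℝ) ≤ r else (I.lo : ℝ) < r) ∧
    ∀ b, I.hi = some b → if I.hiClosed then r ≤ (b : ℝ) else r < (b : ℝ)

/-- Quantifier-free formulae. Atomic propositions and trace variables are named by numbers. -/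
inductive QF
  | top
  | topAt (x : ℕ)
  | atom (p x : ℕ)
  | conj (a b : QF)
  | neg (a : QF)
  | untl (I : Interval) (a b : QF)
  | snce (I : Interval) (a b : QF)

/-- HyperMTL formulae. -/
inductive Formula
  | ex (x : ℕ) (φ : Formula)
  | all (x : ℕ) (φ : Formula)
  | qf (ψ : QF)

/-- Trace assignments: partial maps from trace variables to traces. -/
abbrev Assignment := ℕ → Option (TimedWord ℕ)

/-- Some assigned trace has an event at time `t`. -/
def Assignment.OccursAt (A : Assignment) (t : ℝ≥0) : Prop :=
  ∃ x ρ, A x = some ρ ∧ ρ.OccursAt t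

/-- Pointwise satisfaction of quantifier-free formulae. `ψ.Sat A true t` says that `ψ` holds at
time `t`, and `ψ.Sat A false t` that the negation normal form of `¬ ψ` does; so a negated atomic
proposition also requires an event at `t`, and `⊥` holds exactly where there is no event. -/
def QF.Sat (A : Assignment) : QF → Bool → ℝ≥0 → Prop
  | top, true, t => A.OccursAt t
  | top, false, t => ¬ A.OccursAt t
  | topAt x, true, t => ∃ ρ, A x = some ρ ∧ ρ.OccursAt t
  | topAt x, false, t => ∃ ρ, A x = some ρ ∧ ¬ ρ.OccursAt t
  | atom p x, true, t => ∃ ρ, A x = some ρ ∧ ∃ σ, (σ, t) ∈ ρ.events ∧ p ∈ σ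
  | atom p x, false, t => ∃ ρ, A x = some ρ ∧ ∃ σ, (σ, t) ∈ ρ.events ∧ p ∉ σ
  | conj a b, true, t => a.Sat A true t ∧ b.Sat A true t
  | conj a b, false, t => a.Sat A false t ∨ b.Sat A false t
  | neg a, true, t => a.Sat A false t
  | neg a, false, t => a.Sat A true t
  | untl I a b, true, t => ∃ t', t < t' ∧ I.Mem ((t' : ℝ) - t) ∧ A.OccursAt t' ∧
      b.Sat A true t' ∧ ∀ t'', t < t'' → t'' < t' → A.OccursAt t'' → a.Sat A true t''
  | untl I a b, false, t => ∀ t', t < t' → I.Mem ((t' : ℝ) - t) → A.OccursAt t' →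
      (b.Sat A false t' ∨ ∃ t'', t < t'' ∧ t'' < t' ∧ A.OccursAt t'' ∧ a.Sat A false t'')
  | snce I a b, true, t => ∃ t', t' < t ∧ I.Mem ((t : ℝ) - t') ∧ A.OccursAt t' ∧
      b.Sat A true t' ∧ ∀ t'', t' < t'' → t'' < t → A.OccursAt t'' → a.Sat A true t''
  | snce I a b, false, t => ∀ t', t' < t → I.Mem ((t : ℝ) - t') → A.OccursAt t' →
      (b.Sat A false t' ∨ ∃ t'', t' < t'' ∧ t'' < t ∧ A.OccursAt t'' ∧ a.Sat A false t'')

/-- `ρ` has exactly the same timestamps as every trace in the assignment. -/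
def Synchronises (ρ : TimedWord ℕ) (A : Assignment) : Prop :=
  ∀ x ρ', A x = some ρ' → ∀ t, ρ.OccursAt t ↔ ρ'.OccursAt t

/-- Synchronous satisfaction: every quantifier ranges over the traces of `T` that synchronise
with the traces in the current assignment. -/
def Formula.SyncSat (T : Set (TimedWord ℕ)) (t : ℝ≥0) : Formula → Assignment → Prop
  | ex x φ, A => ∃ ρ ∈ T, Synchronises ρ A ∧ φ.SyncSat T t (Function.update A x (some ρ))
  | all x φ, A => ∀ ρ ∈ T, Synchronises ρ A → φ.SyncSat T t (Function.update A x (some ρ))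
  | qf ψ, A => ψ.Sat A true t

/-- The trace set `T` satisfies the closed formula `φ` in the synchronous semantics. -/
def SyncModels (T : Set (TimedWord ℕ)) (φ : Formula) : Prop :=
  φ.SyncSat T 0 (fun _ => none)

/-- The atomic propositions and trace variables of a quantifier-free formula are all in `D`
and `V`, respectively. -/
def QF.Over (D V : Set ℕ) : QF → Prop
  | top => True
  | topAt x => x ∈ V
  | atom p x => p ∈ D ∧ x ∈ V
  | conj a b => a.Over D V ∧ b.Over D V
  | neg a => a.Over D V
  | untl _ a b => a.Over D V ∧ b.Over D V
  | snce _ a b => a.Over D V ∧ b.Over D V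

/-- The quantified trace variables, in order. -/
def Formula.vars : Formula → List ℕ
  | ex x φ => x :: φ.vars
  | all x φ => x :: φ.vars
  | qf _ => []

/-- The quantifier-free part. -/
def Formula.matrix : Formula → QF
  | ex _ φ => φ.matrix
  | all _ φ => φ.matrix
  | qf ψ => ψ

/-- `φ` is a closed formula over the atomic propositions in `D`, each of whose quantifiers uses a
fresh trace variable. -/
def Formula.ClosedOver (φ : Formula) (D : Set ℕ) : Prop :=
  φ.vars.Nodup ∧ φ.matrix.Over D {x | x ∈ φ.vars}

/-- The quantifier pattern `∀*`. -/
def Formula.IsForall : Formula → Prop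
  | ex _ _ => False
  | all _ φ => φ.IsForall
  | qf _ => True

/-- The quantifier pattern `∃*∀*`. -/
def Formula.IsExistsForall : Formula → Prop
  | ex _ φ => φ.IsExistsForall
  | all _ φ => φ.IsForall
  | qf _ => True

/-- The quantifier pattern `∃∀∀`. -/
def Formula.IsExistsForallForall (φ : Formula) : Prop :=
  ∃ a b c ψ, φ = .ex a (.all b (.all c (.qf ψ)))

/-! ### Translation of the quantifier-free part into an automaton -/

/-- The component of the trace variable `x` in a timed word over propositions `p_x`, which are
written `(p, x)`. -/
def TimedWord.component (ρ : TimedWord (ℕ × ℕ)) (x : ℕ) : TimedWord ℕ where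
  events := ρ.events.map fun e => ((e.1.filter fun q => q.2 = x).image Prod.fst, e.2)
  increasing := by
    have h := ρ.increasing
    rw [List.map_map]
    exact h

/-- The trace assignment described by a timed word over `AP × V`. -/
def TimedWord.toAssignment (ρ : TimedWord (ℕ × ℕ)) (V : List ℕ) : Assignment :=
  fun x => if x ∈ V then some (ρ.component x) else none

/-- The propositions `p_x` with `p ∈ AP = {0, …, n - 1}` and `x` a trace variable in `V`. -/
def indexedProps (n : ℕ) (V : List ℕ) : Set (ℕ × ℕ) := {q | q.1 < n ∧ q.2 ∈ V}

/-- Over the atomic propositions `{0, …, n - 1}`, the quantifier-free part of `φ` translates into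
the metric interval automaton `B`: `B` accepts exactly those tuples of synchronised traces, read as
timed words over the indexed propositions, that satisfy the quantifier-free part. -/
def TranslatesInto (n : ℕ) (φ : Formula) (B : TA (ℕ × ℕ)) : Prop :=
  B.IsMIA (indexedProps n φ.vars) ∧
    ∀ ρ : TimedWord (ℕ × ℕ), ρ.Over (indexedProps n φ.vars) →
      (B.Accepts ρ ↔ φ.matrix.Sat (ρ.toAssignment φ.vars) true 0)

/-! ### Model-checking instances -/

/-- An input of the model-checking problem: the number `n` of atomic propositions `0, …, n - 1`,
a model and a specification. -/
structure Instance where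
  n : ℕ
  model : TA ℕ
  spec : Formula

/-- The data form a proper input of the problem with an untimed model. -/
structure Instance.Valid (i : Instance) : Prop where
  model_wellFormed : i.model.WellFormed {p | p < i.n}
  model_untimed : i.model.Untimed
  spec_closed : i.spec.ClosedOver {p | p < i.n}

/-- The question: does the model satisfy the specification in the synchronous semantics? -/
def Instance.Holds (i : Instance) : Prop := SyncModels i.model.language i.spec

/-! ### Encoding of inputs by natural numbers -/

def Cmp.code : Cmp → ℕ
  | le => 0
  | lt => 1
  | ge => 2
  | gt => 3

def ClockAtom.code (a : ClockAtom) : ℕ := Encodable.encode (a.clock, a.cmp.code, a.const)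

def Transition.code {P : Type} [Encodable P] (e : Transition P) : ℕ :=
  Encodable.encode (e.src, e.letter, e.guard.map ClockAtom.code, e.reset, e.dst)

def TA.code {P : Type} [Encodable P] (A : TA P) : ℕ :=
  Encodable.encode (A.locs, A.init, A.clocks, A.trans.map Transition.code, A.acc)

def Interval.code (I : Interval) : ℕ := Encodable.encode (I.lo, I.hi, I.loClosed, I.hiClosed)

def QF.code : QF → ℕ
  | top => Nat.pair 0 0
  | topAt x => Nat.pair 1 x
  | atom p x => Nat.pair 2 (Nat.pair p x)
  | conj a b => Nat.pair 3 (Nat.pair a.code b.code)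
  | neg a => Nat.pair 4 a.code
  | untl I a b => Nat.pair 5 (Nat.pair I.code (Nat.pair a.code b.code))
  | snce I a b => Nat.pair 6 (Nat.pair I.code (Nat.pair a.code b.code))

def Formula.code : Formula → ℕ
  | ex x φ => Nat.pair 0 (Nat.pair x φ.code)
  | all x φ => Nat.pair 1 (Nat.pair x φ.code)
  | qf ψ => Nat.pair 2 ψ.code

def Instance.code (i : Instance) : ℕ :=
  Encodable.encode (i.n, i.model.code, i.spec.code)

theorem Cmp.code_injective : Function.Injective Cmp.code := by
  intro a b h
  cases a <;> cases b <;> simp_all [Cmp.code]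

theorem ClockAtom.code_injective : Function.Injective ClockAtom.code := by
  rintro ⟨x, c, k⟩ ⟨x', c', k'⟩ h
  have h' := Encodable.encode_injective h
  simp only [Prod.mk.injEq] at h'
  obtain ⟨rfl, h2, rfl⟩ := h'
  rw [Cmp.code_injective h2]

theorem Transition.code_injective {P : Type} [Encodable P] :
    Function.Injective (Transition.code (P := P)) := by
  rintro ⟨s, l, g, r, d⟩ ⟨s', l', g', r', d'⟩ h
  have h' := Encodable.encode_injective h
  simp only [Prod.mk.injEq] at h'
  obtain ⟨rfl, rfl, h3, rfl, rfl⟩ := h'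
  rw [List.map_injective_iff.2 ClockAtom.code_injective h3]

theorem TA.code_injective {P : Type} [Encodable P] : Function.Injective (TA.code (P := P)) := by
  rintro ⟨l, i, c, t, a⟩ ⟨l', i', c', t', a'⟩ h
  have h' := Encodable.encode_injective h
  simp only [Prod.mk.injEq] at h'
  obtain ⟨rfl, rfl, rfl, h4, rfl⟩ := h'
  rw [List.map_injective_iff.2 Transition.code_injective h4]

theorem Interval.code_injective : Function.Injective Interval.code := by
  rintro ⟨a, b, c, d, _⟩ ⟨a', b', c', d', _⟩ h
  have h' := Encodable.encode_injective h
  simp only [Prod.mk.injEq] at h'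
  obtain ⟨rfl, rfl, rfl, rfl⟩ := h'
  rfl

theorem QF.code_injective : Function.Injective QF.code := by
  intro a
  induction a with
  | top => intro b h; cases b <;> simp_all [QF.code, Nat.pair_eq_pair]
  | topAt x => intro b h; cases b <;> simp_all [QF.code, Nat.pair_eq_pair]
  | atom p x => intro b h; cases b <;> simp_all [QF.code, Nat.pair_eq_pair]
  | conj a b iha ihb =>
    intro c h
    cases c <;> simp only [QF.code, Nat.pair_eq_pair] at h <;> try omega
    rw [iha h.2.1, ihb h.2.2]
  | neg a iha =>
    intro c h
    cases c <;> simp only [QF.code, Nat.pair_eq_pair] at h <;> try omega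
    rw [iha h.2]
  | untl I a b iha ihb =>
    intro c h
    cases c <;> simp only [QF.code, Nat.pair_eq_pair] at h <;> try omega
    rw [Interval.code_injective h.2.1, iha h.2.2.1, ihb h.2.2.2]
  | snce I a b iha ihb =>
    intro c h
    cases c <;> simp only [QF.code, Nat.pair_eq_pair] at h <;> try omega
    rw [Interval.code_injective h.2.1, iha h.2.2.1, ihb h.2.2.2]

theorem Formula.code_injective : Function.Injective Formula.code := by
  intro a
  induction a with
  | ex x φ ih =>
    intro c h
    cases c <;> simp only [Formula.code, Nat.pair_eq_pair] at h <;> try omega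
    rw [h.2.1, ih h.2.2]
  | all x φ ih =>
    intro c h
    cases c <;> simp only [Formula.code, Nat.pair_eq_pair] at h <;> try omega
    rw [h.2.1, ih h.2.2]
  | qf ψ =>
    intro c h
    cases c <;> simp only [Formula.code, Nat.pair_eq_pair] at h <;> try omega
    rw [QF.code_injective h.2]

/-- Different inputs have different codes. -/
theorem Instance.code_injective : Function.Injective Instance.code := by
  rintro ⟨n, A, φ⟩ ⟨n', A', φ'⟩ h
  have h' := Encodable.encode_injective h
  simp only [Prod.mk.injEq] at h'
  obtain ⟨rfl, h2, h3⟩ := h'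
  rw [TA.code_injective h2, Formula.code_injective h3]

/-! ### Undecidability -/

open Classical in
/-- The problem with inputs in `K`, encoded by `code`, and with question `Q` is decidable: some
partial recursive function halts on the code of every input in `K` with the correct answer (nothing
is required of it on other numbers). -/
def DecidableOn {ι : Type} (code : ι → ℕ) (K : Set ι) (Q : ι → Prop) : Prop :=
  ∃ f : ℕ →. Bool, Partrec f ∧ ∀ i ∈ K, f (code i) = Part.some (decide (Q i))

end HyperMTL

namespace HyperMTL

/-! ### Stack machines with finitely many control states -/

/-! The proof reduces from a halting problem. Some fixed stack machine has an undecidable halting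
problem on the inputs `z ^ x t₁ t₂` (`exists_stackMachine_not_computable`). A computation is written
as a word of pairs (r, w), where r is a symbol that is read and w the symbol that replaces it. If
every letter reads what was written exactly N letters before, the word is a queue of constant length
N, and a finite automaton that scans this queue over and over simulates the machine as long as the
stacks fit into it. As N is not bounded in advance, the machine halts if and only if some accepted
word has such a constant delay (`StackMachine.rowAccepts_iff_halts`).

It remains to enforce a constant delay with an untimed model and a formula whose quantifier-free
part is easy for an automaton. The model accepts the computation words and also words of marks, at
arbitrary times. The trace π_a is a computation together with a choice of timestamps τ; π_b has the
same timestamps and ranges over all words of marks; π_c is not mentioned by the matrix. The matrix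
asks for a marked pair of events at distance at least 1, or for one at distance less than 1, or for
a letter that agrees with a mark in a suitable way. A nondeterministic one-clock automaton guesses
the right alternative, resets its clock at the start of a test and compares it with 1 at the end, so
no singular guard occurs (`spec_translatesInto`).

The universal quantifier over marks turns these disjunctions into a conjunction of implications.
Marks on positions i, i + 1, j, j + 1 express that τ i + 1 ≤ τ j holds if and only if τ (i + 1) + 1
≤ τ (j + 1) does. Hence, if N is the first position at distance at least 1 from position 0, then i +
N is the first position at distance at least 1 from i, for every i; a further pattern makes letter i
+ N read what letter i wrote (`delay_of_succeeds`). Conversely, the equidistant times (k + 1) / N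
pass all tests (`succeeds_of_delay`). Distances are thus only ever compared with 1 and never
required to equal 1. The equivalence is `syncModels_iff_rowAccepts`, and the instance is computable
from x. -/

/-- Instructions of a machine with stacks `K`, stack symbols `G` and control states `Q`. -/
inductive Instr (K G Q : Type)
  | halt
  | push (k : K) (g : G) (q : Q)
  | read (k : K) (erase : Bool) (next : Option G → Q)

namespace Instr

variable {K G Q : Type} [DecidableEq K]

/-- The transition function of a program. -/
def step (prog : Q → Instr K G Q) : Q × (K → List G) → Option (Q × (K → List G))
  | (q, S) =>
    match prog q with
    | halt => none
    | push k g q' => some (q', Function.update S k (g :: S k))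
    | read k e next =>
      some (next (S k).head?, if e then Function.update S k (S k).tail else S)

/-- The program halts when started in the control state `q` with stacks `S`. -/
def Halts (prog : Q → Instr K G Q) (q : Q) (S : K → List G) : Prop :=
  (StateTransition.eval (step prog) (q, S)).Dom

end Instr

section TM2

open Turing

variable {K G Λ σ : Type}

/-- The control states of the stack machine that simulates the part `S` of a `TM2` program. -/
abbrev TM2Ctrl (M : Λ → TM2.Stmt (fun _ : K => G) Λ σ) (S : Finset Λ) : Type :=
  ({l // l ∈ S} ⊕ {s // some s ∈ TM2.stmts M S}) × σ

variable {M : Λ → TM2.Stmt (fun _ : K => G) Λ σ} {S : Finset Λ}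

theorem mem_stmts_of_mem {l : Λ} (h : l ∈ S) : some (M l) ∈ TM2.stmts M S := by
  simp only [TM2.stmts, Finset.some_mem_insertNone, Finset.mem_biUnion]
  exact ⟨l, h, TM2.stmts₁_self⟩

instance : Finite {s // some s ∈ TM2.stmts M S} :=
  Finite.of_injective (fun s => (⟨some s.1, s.2⟩ : {o // o ∈ TM2.stmts M S}))
    fun _ _ h => Subtype.ext (Option.some_injective _ (congrArg Subtype.val h))

variable [Inhabited K] [DecidableEq K]

/-- The program of the stack machine that simulates `M`, one constructor of a statement at a
time. -/
def tm2Prog (hS : ∀ l ∈ S, TM2.SupportsStmt S (M l)) :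
    TM2Ctrl M S → Instr K G (TM2Ctrl M S)
  | (.inl l, v) => .read default false fun _ => (.inr ⟨M l.1, mem_stmts_of_mem l.2⟩, v)
  | (.inr ⟨.push k f q, h⟩, v) =>
    .push k (f v) (.inr ⟨q, TM2.stmts_trans (by simp [TM2.stmts₁, TM2.stmts₁_self]) h⟩, v)
  | (.inr ⟨.peek k f q, h⟩, v) => .read k false fun o =>
    (.inr ⟨q, TM2.stmts_trans (by simp [TM2.stmts₁, TM2.stmts₁_self]) h⟩, f v o)
  | (.inr ⟨.pop k f q, h⟩, v) => .read k true fun o =>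
    (.inr ⟨q, TM2.stmts_trans (by simp [TM2.stmts₁, TM2.stmts₁_self]) h⟩, f v o)
  | (.inr ⟨.load a q, h⟩, v) => .read default false fun _ =>
    (.inr ⟨q, TM2.stmts_trans (by simp [TM2.stmts₁, TM2.stmts₁_self]) h⟩, a v)
  | (.inr ⟨.branch f q₁ q₂, h⟩, v) => .read default false fun _ =>
    (.inr (if f v then ⟨q₁, TM2.stmts_trans (by simp [TM2.stmts₁, TM2.stmts₁_self]) h⟩
      else ⟨q₂, TM2.stmts_trans (by simp [TM2.stmts₁, TM2.stmts₁_self]) h⟩), v)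
  | (.inr ⟨.goto f, h⟩, v) => .read default false fun _ =>
    (.inl ⟨f v, by
      obtain ⟨l, hl, hm⟩ : ∃ l ∈ S, TM2.Stmt.goto f ∈ TM2.stmts₁ (M l) := by
        simpa [TM2.stmts] using h
      exact TM2.stmts₁_supportsStmt_mono hm (hS l hl) v⟩, v)
  | (.inr ⟨.halt, _⟩, _) => .halt

variable (hS : ∀ l ∈ S, TM2.SupportsStmt S (M l))

/-- The configurations of the stack machine at which a configuration of the `TM2` machine is
reached. -/
def TM2Rel : TM2.Cfg (fun _ : K => G) Λ σ → TM2Ctrl M S × (K → List G) → Prop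
  | ⟨some l, v, T⟩, c => ∃ h : l ∈ S, c = ((.inl ⟨l, h⟩, v), T)
  | ⟨none, v, T⟩, c => ∃ h, c = ((.inr ⟨.halt, h⟩, v), T)

/-- A `TM2` machine executes a whole statement in one step, so the statement is unrolled by
induction, one instruction for each constructor. `load`, `branch` and `goto` become a read that
neither erases nor depends on the symbol found. -/
theorem tm2Rel_stepAux (s : TM2.Stmt (fun _ : K => G) Λ σ) (h : some s ∈ TM2.stmts M S) (v : σ)
    (T : K → List G) : ∃ c, TM2Rel (M := M) (S := S) (TM2.stepAux s v T) c ∧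
      StateTransition.Reaches (Instr.step (tm2Prog hS)) ((.inr ⟨s, h⟩, v), T) c := by
  induction s generalizing v T with
  | push k f q ih =>
    obtain ⟨c, hc, hr⟩ := ih (TM2.stmts_trans (by simp [TM2.stmts₁, TM2.stmts₁_self]) h) v
      (Function.update T k (f v :: T k))
    exact ⟨c, hc, .head (by simp [Instr.step, tm2Prog]) hr⟩
  | peek k f q ih =>
    obtain ⟨c, hc, hr⟩ := ih (TM2.stmts_trans (by simp [TM2.stmts₁, TM2.stmts₁_self]) h)
      (f v (T k).head?) T
    exact ⟨c, hc, .head (by simp [Instr.step, tm2Prog]) hr⟩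
  | pop k f q ih =>
    obtain ⟨c, hc, hr⟩ := ih (TM2.stmts_trans (by simp [TM2.stmts₁, TM2.stmts₁_self]) h)
      (f v (T k).head?) (Function.update T k (T k).tail)
    exact ⟨c, hc, .head (by simp [Instr.step, tm2Prog]) hr⟩
  | load a q ih =>
    obtain ⟨c, hc, hr⟩ := ih (TM2.stmts_trans (by simp [TM2.stmts₁, TM2.stmts₁_self]) h) (a v) T
    exact ⟨c, hc, .head (by simp [Instr.step, tm2Prog]) hr⟩
  | branch f q₁ q₂ ih₁ ih₂ =>
    cases hf : f v
    · obtain ⟨c, hc, hr⟩ := ih₂ (TM2.stmts_trans (by simp [TM2.stmts₁, TM2.stmts₁_self]) h) v T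
      exact ⟨c, by simpa [TM2.stepAux, hf] using hc,
        .head (by simp [Instr.step, tm2Prog, hf]) hr⟩
    · obtain ⟨c, hc, hr⟩ := ih₁ (TM2.stmts_trans (by simp [TM2.stmts₁, TM2.stmts₁_self]) h) v T
      exact ⟨c, by simpa [TM2.stepAux, hf] using hc,
        .head (by simp [Instr.step, tm2Prog, hf]) hr⟩
  | goto f =>
    obtain ⟨l, hl, hm⟩ : ∃ l ∈ S, TM2.Stmt.goto f ∈ TM2.stmts₁ (M l) := by
      simpa [TM2.stmts] using h
    exact ⟨_, ⟨TM2.stmts₁_supportsStmt_mono hm (hS l hl) v, rfl⟩,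
      .single (by simp [Instr.step, tm2Prog])⟩
  | halt => exact ⟨_, ⟨h, rfl⟩, .refl⟩

theorem tm2Prog_respects :
    StateTransition.Respects (TM2.step M) (Instr.step (tm2Prog hS)) TM2Rel := by
  rintro ⟨_ | l, v, T⟩ c hc
  · obtain ⟨h, rfl⟩ := hc
    simp [TM2.step, Instr.step, tm2Prog]
  · obtain ⟨h, rfl⟩ := hc
    obtain ⟨c, hc, hr⟩ := tm2Rel_stepAux hS (M l) (mem_stmts_of_mem h) v T
    exact ⟨c, hc, .head' (by simp [Instr.step, tm2Prog]) hr⟩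

theorem tm2Prog_halts_iff {l : Λ} (h : l ∈ S) (v : σ) (T : K → List G) :
    Instr.Halts (tm2Prog hS) (.inl ⟨l, h⟩, v) T ↔
      (StateTransition.eval (TM2.step M) ⟨some l, v, T⟩).Dom :=
  StateTransition.tr_eval_dom (tm2Prog_respects hS) ⟨h, rfl⟩

end TM2

/-! ### A stack machine with an undecidable halting problem -/

/-- Numbers are written in binary with the least significant bit first, so a power of two is a unary
block followed by an end marker. Such an input can be spelled out by a chain of `x` locations. -/
theorem trNat_two_pow (x : ℕ) : Turing.PartrecToTM2.trNat (2 ^ x) =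
    List.replicate x Turing.PartrecToTM2.Γ'.bit0 ++ [Turing.PartrecToTM2.Γ'.bit1] := by
  have key : ∃ p : PosNum, ((2 ^ x : ℕ) : Num) = Num.pos p ∧ Turing.PartrecToTM2.trPosNum p =
      List.replicate x Turing.PartrecToTM2.Γ'.bit0 ++ [Turing.PartrecToTM2.Γ'.bit1] := by
    induction x with
    | zero => exact ⟨1, by simp; rfl, rfl⟩
    | succ x ih =>
      obtain ⟨p, hp, ht⟩ := ih
      refine ⟨p.bit0, ?_, by simp [Turing.PartrecToTM2.trPosNum, ht, List.replicate_succ]⟩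
      rw [pow_succ, mul_two, Nat.cast_add, hp, Num.bit0_of_bit0 (Num.pos p)]
      rfl
  obtain ⟨p, hp, ht⟩ := key
  rw [Turing.PartrecToTM2.trNat, hp]
  exact ht

theorem primrec_two_pow : Primrec fun x : ℕ => 2 ^ x := by
  refine (Primrec.nat_rec₁ (f := fun _ r => r * 2) 1
    (Primrec.nat_mul.comp Primrec.snd (Primrec.const 2))).of_eq fun x => ?_
  induction x with
  | zero => rfl
  | succ x ih => rw [pow_succ, ← ih]

/-- The code recovers `x` from `2 ^ x` by unbounded search and then runs the program with number `x`
on the input `0`. Deciding its domain on powers of two would solve the halting problem. -/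
theorem exists_code_not_computable : ∃ c : Turing.ToPartrec.Code,
    ¬ ComputablePred fun x : ℕ => (c.eval [2 ^ x]).Dom := by
  have hU : Partrec fun y : ℕ => (Nat.rfind fun x => Part.some (decide (2 ^ x = y))).bind
      fun x => (Denumerable.ofNat Nat.Partrec.Code x).eval 0 := by
    refine Partrec.bind (Partrec.rfind ?_) ?_
    · exact (Primrec.eq.decide.comp (primrec_two_pow.comp Primrec.snd)
        Primrec.fst).to_comp
    · exact Nat.Partrec.Code.eval_part.comp ((Computable.ofNat _).comp Computable.snd)
        (Computable.const 0)
  obtain ⟨c, hc⟩ := Turing.ToPartrec.Code.exists_code (Nat.Partrec'.part_iff₁.2 hU)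
  refine ⟨c, fun h => ComputablePred.halting_problem 0 ?_⟩
  have hx : ∀ x : ℕ, (c.eval [2 ^ x]).Dom ↔
      ((Denumerable.ofNat Nat.Partrec.Code x).eval 0).Dom := by
    intro x
    have h1 := hc ⟨[2 ^ x], rfl⟩
    have h2 : (Nat.rfind fun x' => Part.some (decide (2 ^ x' = 2 ^ x))) = Part.some x := by
      refine Part.eq_some_iff.2 (Nat.mem_rfind.2 ⟨by simp, fun {m} hm => ?_⟩)
      simp [Nat.pow_right_injective (le_refl 2) |>.eq_iff, hm.ne]
    change c.eval [2 ^ x] = _ at h1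
    rw [h1]
    change (Part.map _ ((Nat.rfind fun x' => Part.some (decide (2 ^ x' = 2 ^ x))).bind _)).Dom ↔ _
    rw [h2, Part.bind_some]
    rfl
  obtain ⟨f, hf, he⟩ := ComputablePred.computable_iff.1 h
  refine ComputablePred.computable_iff.2 ⟨fun c => f (Encodable.encode c),
    hf.comp Computable.encode, funext fun c' => ?_⟩
  rw [← congrFun he (Encodable.encode c')]
  simp [hx]

instance : Fintype Turing.PartrecToTM2.K' :=
  ⟨{.main, .rev, .aux, .stack}, fun k => by cases k <;> simp⟩

/-- Some stack machine has an undecidable halting problem for the inputs `z ^ x t₁ t₂`. -/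
theorem exists_stackMachine_not_computable :
    ∃ (K G Q : Type) (_ : DecidableEq K) (_ : Fintype K) (_ : Fintype G) (_ : Fintype Q)
      (prog : Q → Instr K G Q) (q₀ : Q) (k₀ : K) (z t₁ t₂ : G),
      ¬ ComputablePred fun x : ℕ => Instr.Halts prog q₀
        (Function.update (fun _ => []) k₀ (List.replicate x z ++ [t₁, t₂])) := by
  classical
  obtain ⟨c, hc⟩ := exists_code_not_computable
  have hs := @Turing.PartrecToTM2.tr_supports c .halt
  have he : ∀ x : ℕ, _ := fun x => Turing.PartrecToTM2.tr_eval c [2 ^ x]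
  have hi : ∀ x : ℕ, Turing.PartrecToTM2.init c [2 ^ x] =
      (⟨some (Turing.PartrecToTM2.trNormal c .halt), none,
        Function.update (fun _ => []) .main (List.replicate x .bit0 ++ [.bit1, .cons])⟩ :
        Turing.TM2.Cfg (fun _ : Turing.PartrecToTM2.K' => Turing.PartrecToTM2.Γ') _ _) := by
    intro x
    rw [Turing.PartrecToTM2.init]
    congr 1
    funext k
    cases k <;> simp [Turing.PartrecToTM2.K'.elim, trNat_two_pow, Function.update]
  obtain ⟨M, hM⟩ : ∃ M : Turing.PartrecToTM2.Λ' → Turing.TM2.Stmt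
    (fun _ : Turing.PartrecToTM2.K' => Turing.PartrecToTM2.Γ') Turing.PartrecToTM2.Λ'
    (Option Turing.PartrecToTM2.Γ'), M = Turing.PartrecToTM2.tr := ⟨_, rfl⟩
  -- `codeSupp` is a finite set of labels that is closed under jumps; this makes the control of the
  -- stack machine finite.
  have hS : ∀ l ∈ Turing.PartrecToTM2.codeSupp c .halt, Turing.TM2.SupportsStmt
    (Turing.PartrecToTM2.codeSupp c .halt) (M l) := by subst hM; exact hs.2
  refine ⟨_, _, TM2Ctrl M _, inferInstance, inferInstance, inferInstance,
    Fintype.ofFinite _, tm2Prog hS, (.inl ⟨Turing.PartrecToTM2.trNormal c .halt, hs.1⟩, none),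
    .main, .bit0, .bit1, .cons, fun h => hc ?_⟩
  convert h using 2 with x
  refine Iff.trans ?_ (tm2Prog_halts_iff hS hs.1 none _).symm
  have hx := congrArg Part.Dom (he x)
  rw [hi x, ← hM] at hx
  exact (iff_of_eq hx).symm

/-! ### Paths in labelled graphs -/

/-- `Path E s w t`: the word `w` labels a path from `s` to `t`. -/
inductive Path {α β : Type} (E : α → β → α → Prop) : α → List β → α → Prop
  | nil (s : α) : Path E s [] s
  | cons {s t u : α} {a : β} {w : List β} : E s a t → Path E t w u → Path E s (a :: w) u

namespace Path

variable {α β : Type} {E : α → β → α → Prop}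

theorem append {s t u : α} {v w : List β} (h : Path E s v t) (h' : Path E t w u) :
    Path E s (v ++ w) u := by
  induction h with
  | nil => exact h'
  | cons e _ ih => exact cons e (ih h')

theorem single {s t : α} {a : β} (h : E s a t) : Path E s [a] t := cons h (nil t)

theorem nil_iff {s t : α} : Path E s [] t ↔ s = t :=
  ⟨fun h => by cases h; rfl, fun h => h ▸ nil s⟩

theorem cons_iff {s u : α} {a : β} {w : List β} :
    Path E s (a :: w) u ↔ ∃ t, E s a t ∧ Path E t w u :=
  ⟨fun h => by cases h with | cons e h => exact ⟨_, e, h⟩, fun ⟨_, e, h⟩ => cons e h⟩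

end Path

/-! ### A finite automaton whose words, read with a fixed delay, simulate a stack machine -/

/-- A stack machine together with the data that describe its inputs `z ^ x t₁ t₂`. -/
structure StackMachine (K G Q : Type) where
  prog : Q → Instr K G Q
  q₀ : Q
  k₀ : K
  z : G
  t₁ : G
  t₂ : G

/-- The stacks of the machine for the input `x`. -/
def StackMachine.input {K G Q : Type} [DecidableEq K] (M : StackMachine K G Q) (x : ℕ) :
    K → List G :=
  Function.update (fun _ => []) M.k₀ (List.replicate x M.z ++ [M.t₁, M.t₂])

/-- The symbols of a row: a cell holds at most one symbol of every stack, and each row starts with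
`hash`, or with `first` in the case of the first row. -/
inductive Sym (K G : Type)
  | hash
  | first
  | cell (c : K → Option G)

/-- The states in which a row is scanned: `ready q` copies it, `carry k g q` inserts `g` on top
of the stack `k`, and `find q` looks for the top of the stack that is read in the control state
`q`. -/
inductive Scan (K G Q : Type)
  | ready (q : Q)
  | carry (k : K) (g : G) (q : Q)
  | find (q : Q)

/-- The patterns of marks. -/
inductive Pattern (K G : Type)
  | gap
  | fwd
  | bwd
  | copy (s : Sym K G)

/-- The locations of the model, apart from those that count the input. -/
inductive Loc (K G Q : Type)
  | start
  | acc
  | tail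
  | pad
  | scan (s : Scan K G Q)
  | idle
  | mark₁ (p : Pattern K G)
  | mark₂ (p : Pattern K G)
  | mark₃ (p : Pattern K G)
  | fin
  | whole

section Cells

variable {K G : Type}

/-- The contents of the stack `k` in a row of cells. -/
def stack (row : List (K → Option G)) (k : K) : List G := row.filterMap fun c => c k

@[simp] theorem stack_append (a b : List (K → Option G)) (k : K) :
    stack (a ++ b) k = stack a k ++ stack b k := List.filterMap_append

@[simp] theorem stack_nil (k : K) : stack ([] : List (K → Option G)) k = [] := rfl

theorem stack_cons (c : K → Option G) (b : List (K → Option G)) (k : K) :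
    stack (c :: b) k = (c k).toList ++ stack b k := by
  cases h : c k <;> simp [stack, h]

/-- The number of cells of a row in which the stack `k` has no symbol. -/
def blanks (row : List (K → Option G)) (k : K) : ℕ := row.countP fun c => (c k).isNone

theorem blanks_cons (c : K → Option G) (row : List (K → Option G)) (k : K) :
    blanks (c :: row) k = blanks row k + if (c k).isNone then 1 else 0 := by
  simp [blanks, List.countP_cons]

/-- The letters that replace the cells `p.1` by `p.2`. -/
def cellLetters (v : List ((K → Option G) × (K → Option G))) : List (Sym K G × Sym K G) :=
  v.map fun p => (.cell p.1, .cell p.2)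

theorem map_fst_cellLetters (v : List ((K → Option G) × (K → Option G))) :
    (cellLetters v).map Prod.fst = (v.map Prod.fst).map .cell := by
  simp [cellLetters]

theorem map_snd_cellLetters (v : List ((K → Option G) × (K → Option G))) :
    (cellLetters v).map Prod.snd = (v.map Prod.snd).map .cell := by
  simp [cellLetters]

end Cells

section Simulation

variable {K G Q : Type} [DecidableEq K]

/-- `ScanEdge prog s r w s'`: in the state `s`, a symbol `r` is replaced by `w`. -/
inductive ScanEdge (prog : Q → Instr K G Q) : Scan K G Q → Sym K G → Sym K G → Scan K G Q → Prop
  | copy (q : Q) (c : K → Option G) : ScanEdge prog (.ready q) (.cell c) (.cell c) (.ready q)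
  | push {q : Q} {k : K} {g : G} {q' : Q} : prog q = .push k g q' →
      ScanEdge prog (.ready q) .hash .hash (.carry k g q')
  | shift {k : K} {g g' : G} {q : Q} {c : K → Option G} : c k = some g' →
      ScanEdge prog (.carry k g q) (.cell c) (.cell (Function.update c k (some g))) (.carry k g' q)
  | put {k : K} {g : G} {q : Q} {c : K → Option G} : c k = none →
      ScanEdge prog (.carry k g q) (.cell c) (.cell (Function.update c k (some g))) (.ready q)
  | read {q : Q} {k : K} {e : Bool} {next : Option G → Q} : prog q = .read k e next →
      ScanEdge prog (.ready q) .hash .hash (.find q)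
  | skip {q : Q} {k : K} {e : Bool} {next : Option G → Q} {c : K → Option G} :
      prog q = .read k e next → c k = none →
      ScanEdge prog (.find q) (.cell c) (.cell c) (.find q)
  | found {q : Q} {k : K} {e : Bool} {next : Option G → Q} {g : G} {c : K → Option G} :
      prog q = .read k e next → c k = some g →
      ScanEdge prog (.find q) (.cell c) (.cell (if e then Function.update c k none else c))
        (.ready (next (some g)))
  | empty {q : Q} {k : K} {e : Bool} {next : Option G → Q} : prog q = .read k e next →
      ScanEdge prog (.find q) .hash .hash (.ready (next none))

/-- A cell that only holds the symbol `g` of the input stack. -/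
def StackMachine.single (M : StackMachine K G Q) (g : G) : K → Option G :=
  Function.update (fun _ => none) M.k₀ (some g)

/-- The edges for the rows of a computation with input `x`. The label `(r, w)` consists of a symbol
that is read and of the symbol that replaces it in the next row. -/
inductive RowEdge (M : StackMachine K G Q) (x : ℕ) :
    Loc K G Q ⊕ ℕ → Sym K G × Sym K G → Loc K G Q ⊕ ℕ → Prop
  | start : RowEdge M x (.inl .start) (.hash, .first) (.inr x)
  | count {k : ℕ} : k < x → RowEdge M x (.inr (k + 1)) (.hash, .cell (M.single M.z)) (.inr k)
  | tail₁ : RowEdge M x (.inr 0) (.hash, .cell (M.single M.t₁)) (.inl .tail)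
  | tail₂ : RowEdge M x (.inl .tail) (.hash, .cell (M.single M.t₂)) (.inl .pad)
  | pad : RowEdge M x (.inl .pad) (.hash, .cell fun _ => none) (.inl .pad)
  | enter : RowEdge M x (.inl .pad) (.first, .hash) (.inl (.scan (.ready M.q₀)))
  | scan {s s' : Scan K G Q} {r w : Sym K G} : ScanEdge M.prog s r w s' →
      RowEdge M x (.inl (.scan s)) (r, w) (.inl (.scan s'))
  | halt {q : Q} : M.prog q = .halt →
      RowEdge M x (.inl (.scan (.ready q))) (.hash, .hash) (.inl .acc)

/-- Some accepted word, read with delay `N`, reads what it wrote `N` letters before. -/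
def StackMachine.RowAccepts (M : StackMachine K G Q) (x : ℕ) : Prop :=
  ∃ u, Path (RowEdge M x) (.inl .start) u (.inl .acc) ∧ ∃ N, 3 ≤ N ∧ N < u.length ∧
    (u.drop N).map Prod.fst <+: u.map Prod.snd

/-- The configuration of the stack machine that is represented when the part `done` of the next
row has been written and the part `todo` of the row remains to be read. -/
def Scan.config : Scan K G Q → List (K → Option G) → List (K → Option G) → Q × (K → List G)
  | .ready q, done, todo => (q, fun j => stack done j ++ stack todo j)
  | .carry k g q, done, todo =>
    (q, fun j => stack done j ++ if j = k then g :: stack todo j else stack todo j)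
  | .find q, done, todo => (q, fun j => stack done j ++ stack todo j)

/-- While the top of a stack is looked for, it has not been found. -/
def Scan.Inv (prog : Q → Instr K G Q) (done : List (K → Option G)) : Scan K G Q → Prop
  | .find q => ∀ k e next, prog q = .read k e next → stack done k = []
  | _ => True

/-! ### Soundness of the row simulation -/

theorem reaches_of_eq {σ : Type} {f : σ → Option σ} {a b : σ} (h : a = b) :
    StateTransition.Reaches f a b := h ▸ .refl

-- Only `found` performs a step of the machine. `shift` and `put` do not change the configuration,
-- because a carried symbol counts as lying on top of the unread part of its stack. `skip` keeps the
-- invariant because the skipped cell has no symbol of the stack that is searched.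
open StateTransition in
theorem ScanEdge.cell_sound {prog : Q → Instr K G Q} {s s' : Scan K G Q} {c : K → Option G}
    {w : Sym K G} {done todo : List (K → Option G)} (h : ScanEdge prog s (.cell c) w s')
    (hi : s.Inv prog done) : ∃ c', w = .cell c' ∧ s'.Inv prog (done ++ [c']) ∧
      Reaches (Instr.step prog) (s.config done (c :: todo)) (s'.config (done ++ [c']) todo) := by
  cases h with
  | copy q => exact ⟨c, rfl, trivial, by simp [Scan.config, stack_cons]; exact .refl⟩
  | @shift k g g' q _ hc =>
    refine ⟨_, rfl, trivial, ?_⟩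
    refine reaches_of_eq (Prod.ext rfl (funext fun j => ?_))
    simp only [Scan.config]
    by_cases hj : j = k
    · subst hj; simp [stack_cons, hc]
    · simp [stack_cons, hj]
  | @put k g q _ hc =>
    refine ⟨_, rfl, trivial, ?_⟩
    refine reaches_of_eq (Prod.ext rfl (funext fun j => ?_))
    simp only [Scan.config]
    by_cases hj : j = k
    · subst hj; simp [stack_cons, hc]
    · simp [stack_cons, hj]
  | @skip q k e next _ hp hc =>
    refine ⟨c, rfl, ?_, by simp [Scan.config, stack_cons]; exact .refl⟩
    intro k' e' next' hp'
    obtain ⟨rfl, -, -⟩ : k = k' ∧ e = e' ∧ next = next' := by simpa [hp] using hp'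
    simp [hi k e next hp, stack_cons, hc]
  | @found q k e next g _ hp hc =>
    have hd := hi k e next hp
    refine ⟨_, rfl, trivial, .single ?_⟩
    cases e <;> simp only [Scan.config, Instr.step, hp, hd, stack_cons, hc, Option.mem_def,
      Option.some.injEq, Prod.mk.injEq] <;> refine ⟨by simp, funext fun j => ?_⟩ <;>
      by_cases hj : j = k <;> (try subst hj) <;> simp_all [stack_cons]

-- At the end of a row, the cells just written become the row to be read. `push` is the machine step
-- itself, as the carried symbol is at once the new top; `empty` is a machine step because the
-- search has passed a whole row without finding a symbol.
open StateTransition in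
theorem ScanEdge.hash_sound {prog : Q → Instr K G Q} {s s' : Scan K G Q} {w : Sym K G}
    {row : List (K → Option G)} (h : ScanEdge prog s .hash w s') (hi : s.Inv prog row) :
    w = .hash ∧ s'.Inv prog [] ∧
      Reaches (Instr.step prog) (s.config row []) (s'.config [] row) := by
  cases h with
  | @push q k g q' hp =>
    refine ⟨rfl, trivial, .single ?_⟩
    simp only [Scan.config, Instr.step, hp, Option.mem_def, Option.some.injEq, Prod.mk.injEq,
      true_and]
    funext j
    by_cases hj : j = k
    · subst hj; simp
    · simp [hj]
  | read hp =>
    refine ⟨rfl, fun _ _ _ _ => rfl, ?_⟩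
    simp [Scan.config]
    exact .refl
  | @empty q k e next hp =>
    have hd := hi k e next hp
    refine ⟨rfl, trivial, .single ?_⟩
    simp only [Scan.config, Instr.step, hp, hd, Option.mem_def, Option.some.injEq, Prod.mk.injEq]
    refine ⟨by simp, funext fun j => ?_⟩
    cases e
    · simp
    · by_cases hj : j = k
      · subst hj; simp [hd]
      · simp [hj]

theorem ScanEdge.ne_first {prog : Q → Instr K G Q} {s s' : Scan K G Q} {r w : Sym K G}
    (h : ScanEdge prog s r w s') : r ≠ .first := by
  cases h <;> simp

variable {M : StackMachine K G Q} {x : ℕ}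

-- The right-hand side of the prefix condition is the queue: the rest of the current row, the
-- separator, the cells already written for the next row, and all later output. Each letter consumes
-- the front and moves its own output into the known part, so the condition keeps its shape along
-- the path.
open StateTransition in
theorem RowEdge.scan_sound (u : List (Sym K G × Sym K G)) : ∀ (s : Scan K G Q)
    (done todo : List (K → Option G)), Path (RowEdge M x) (.inl (.scan s)) u (.inl .acc) →
    s.Inv M.prog done →
    u.map Prod.fst <+: todo.map .cell ++ .hash :: done.map .cell ++ u.map Prod.snd →
    ∃ c, Reaches (Instr.step M.prog) (s.config done todo) c ∧ Instr.step M.prog c = none := by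
  induction u with
  | nil => intro s done todo h; simp [Path.nil_iff] at h
  | cons a u ih =>
    intro s done todo h hi hp
    obtain ⟨r, w⟩ := a
    obtain ⟨t, he, h'⟩ := Path.cons_iff.1 h
    cases todo with
    | nil =>
      simp only [List.map_cons, List.map_nil, List.nil_append, List.cons_append,
        List.cons_prefix_cons] at hp
      obtain ⟨rfl, hp⟩ := hp
      cases he with
      | @scan _ s' _ _ he =>
        obtain ⟨rfl, hi', hr⟩ := he.hash_sound hi
        obtain ⟨c, hc, hn⟩ := ih s' [] done h' hi' (by simpa using hp)
        exact ⟨c, hr.trans hc, hn⟩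
      | halt hq => exact ⟨_, .refl, by simp [Scan.config, Instr.step, hq]⟩
    | cons c todo =>
      simp only [List.map_cons, List.cons_append, List.cons_prefix_cons] at hp
      obtain ⟨rfl, hp⟩ := hp
      cases he with
      | @scan _ s' _ _ he =>
        obtain ⟨c', rfl, hi', hr⟩ := he.cell_sound (todo := todo) hi
        obtain ⟨d, hc, hn⟩ := ih s' (done ++ [c']) todo h' hi' (by simpa using hp)
        exact ⟨d, hr.trans hc, hn⟩

theorem RowEdge.scan_ne_first {s : Scan K G Q} {u : List (Sym K G × Sym K G)}
    (h : Path (RowEdge M x) (.inl (.scan s)) u (.inl .acc)) : ∀ a ∈ u, a.1 ≠ .first := by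
  induction u generalizing s with
  | nil => simp
  | cons a u ih =>
    obtain ⟨t, he, h⟩ := Path.cons_iff.1 h
    cases he with
    | scan he => simpa using ⟨he.ne_first, fun r w hm => ih h (r, w) hm⟩
    | halt =>
      cases u with
      | nil => simp
      | cons b u => obtain ⟨t, he, h⟩ := Path.cons_iff.1 h; cases he

/-- The cells of the first row, with room for `b` further symbols. -/
def StackMachine.cells (M : StackMachine K G Q) (x b : ℕ) : List (K → Option G) :=
  List.replicate x (M.single M.z) ++
    (M.single M.t₁ :: M.single M.t₂ :: List.replicate b fun _ => none)

theorem RowEdge.pad_sound {u : List (Sym K G × Sym K G)}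
    (h : Path (RowEdge M x) (.inl .pad) u (.inl .acc)) : ∃ b v,
      u = (List.replicate b fun _ => none).map (fun c => (.hash, .cell c)) ++ (.first, .hash) :: v ∧
      Path (RowEdge M x) (.inl (.scan (.ready M.q₀))) v (.inl .acc) := by
  induction u with
  | nil => simp [Path.nil_iff] at h
  | cons a u ih =>
    obtain ⟨t, he, h⟩ := Path.cons_iff.1 h
    cases he with
    | pad =>
      obtain ⟨b, v, rfl, hv⟩ := ih h
      exact ⟨b + 1, v, by simp [List.replicate_succ], hv⟩
    | enter => exact ⟨0, u, by simp, h⟩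

theorem RowEdge.count_sound {k : ℕ} {u : List (Sym K G × Sym K G)}
    (h : Path (RowEdge M x) (.inr k) u (.inl .acc)) : ∃ b v,
      u = (M.cells k b).map (fun c => (.hash, .cell c)) ++ (.first, .hash) :: v ∧
      Path (RowEdge M x) (.inl (.scan (.ready M.q₀))) v (.inl .acc) := by
  induction k generalizing u with
  | zero =>
    cases u with
    | nil => simp [Path.nil_iff] at h
    | cons a u =>
      obtain ⟨t, he, h⟩ := Path.cons_iff.1 h
      cases he
      cases u with
      | nil => simp [Path.nil_iff] at h
      | cons a u =>
        obtain ⟨t, he, h⟩ := Path.cons_iff.1 h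
        cases he
        obtain ⟨b, v, rfl, hv⟩ := RowEdge.pad_sound h
        exact ⟨b, v, by simp [StackMachine.cells], hv⟩
  | succ k ih =>
    cases u with
    | nil => simp [Path.nil_iff] at h
    | cons a u =>
      obtain ⟨t, he, h⟩ := Path.cons_iff.1 h
      cases he
      obtain ⟨b, v, rfl, hv⟩ := ih h
      exact ⟨b, v, by simp [StackMachine.cells, List.replicate_succ], hv⟩

theorem StackMachine.stack_cells (x b : ℕ) : stack (M.cells x b) = M.input x := by
  funext k
  have h0 : ∀ b, stack (List.replicate b fun _ : K => (none : Option G)) k = [] := by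
    intro b; simp [stack]
  by_cases hk : k = M.k₀
  · subst hk
    simp only [cells, stack_append, stack_cons, h0, single, input, Function.update_self]
    simp [stack]
  · simp only [cells, stack_append, stack_cons, h0, single, input, Function.update_of_ne hk]
    simp [stack, hk]

/-- The first letter writes `first`, so the letter at position `N` has to read it. Only the letter
that enters the scan reads `first`; hence `N` is exactly the length of the first row, and what
follows is a computation on the padded input. -/
theorem StackMachine.RowAccepts.halts (h : M.RowAccepts x) :
    Instr.Halts M.prog M.q₀ (M.input x) := by
  obtain ⟨u, hu, N, -, hN, hp⟩ := h
  cases hu with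
  | cons he hu =>
    cases he with
    | start =>
      obtain ⟨b, v, rfl, hv⟩ := RowEdge.count_sound hu
      set A : List (Sym K G × Sym K G) :=
        (.hash, .first) :: (M.cells x b).map (fun c => (.hash, .cell c)) with hA
      have hAf : ∀ a ∈ A, a.1 ≠ .first := by
        intro a ha
        simp only [hA, List.mem_cons, List.mem_map] at ha
        rcases ha with rfl | ⟨c, -, rfl⟩ <;> simp
      have hvf := RowEdge.scan_ne_first hv
      rw [← List.cons_append, ← hA] at hp hN
      have hhead : ∀ a l, (A ++ (.first, .hash) :: v).drop N = a :: l → a.1 = .first := by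
        intro a l hal
        rw [hal] at hp
        simp only [hA, List.map_cons, List.cons_append, List.cons_prefix_cons] at hp
        exact hp.1
      rcases lt_trichotomy N A.length with hlt | rfl | hgt
      · exfalso
        rw [List.drop_append_of_le_length hlt.le, List.drop_eq_getElem_cons hlt] at hhead
        exact hAf _ (List.getElem_mem hlt) (hhead _ _ rfl)
      · rw [List.drop_left] at hp
        simp only [hA, List.map_cons, List.cons_append, List.cons_prefix_cons, true_and] at hp
        obtain ⟨c, hc, hn⟩ := RowEdge.scan_sound v (.ready M.q₀) [] (M.cells x b) hv trivial
          (by simpa [Function.comp_def] using hp)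
        refine Part.dom_iff_mem.2 ⟨c, StateTransition.mem_eval.2 ⟨?_, hn⟩⟩
        simpa [Scan.config, StackMachine.stack_cells] using hc
      · exfalso
        obtain ⟨d, rfl⟩ : ∃ d, N = A.length + (d + 1) := ⟨N - A.length - 1, by omega⟩
        have hd : d < v.length := by simp at hN; omega
        rw [List.drop_append, List.drop_eq_nil_of_le (by omega)] at hhead
        simp only [Nat.add_sub_cancel_left, List.drop_succ_cons, List.nil_append] at hhead
        rw [List.drop_eq_getElem_cons hd] at hhead
        exact hvf _ (List.getElem_mem hd) (hhead _ _ rfl)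

/-! ### Completeness of the row simulation -/

theorem path_copy (q : Q) (row : List (K → Option G)) : Path (RowEdge M x)
    (.inl (.scan (.ready q))) (cellLetters (row.map fun c => (c, c)))
    (.inl (.scan (.ready q))) := by
  induction row with
  | nil => exact .nil _
  | cons c row ih => exact .cons (.scan (.copy q c)) ih

/-- The carried symbol is exchanged with each symbol of its stack in turn, up to the first blank of
that stack, which absorbs the last one. The final clause is the cost of a push: at most one blank in
each stack. -/
theorem exists_path_carry (k : K) (g : G) (q : Q) (row : List (K → Option G))
    (hb : 0 < blanks row k) : ∃ v, v.map Prod.fst = row ∧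
      Path (RowEdge M x) (.inl (.scan (.carry k g q))) (cellLetters v)
        (.inl (.scan (.ready q))) ∧
      (∀ j, stack (v.map Prod.snd) j = if j = k then g :: stack row j else stack row j) ∧
      ∀ j, blanks row j ≤ blanks (v.map Prod.snd) j + 1 := by
  induction row generalizing g with
  | nil => simp [blanks] at hb
  | cons c row ih =>
    cases hc : c k with
    | none =>
      refine ⟨(c, Function.update c k (some g)) :: row.map fun c => (c, c), ?_,
        .cons (.scan (.put hc)) (path_copy q row), ?_, ?_⟩
      · simp [Function.comp_def]
      · intro j
        by_cases hj : j = k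
        · subst hj; simp [stack_cons, hc, Function.comp_def]
        · simp [stack_cons, hj, Function.comp_def]
      · intro j
        simp only [List.map_cons, List.map_map, Function.comp_def, List.map_id', blanks_cons]
        split_ifs <;> omega
    | some g' =>
      obtain ⟨v, hv, hp, hs, hn⟩ := ih g' (by simpa [blanks_cons, hc] using hb)
      refine ⟨(c, Function.update c k (some g)) :: v, by simp [hv],
        .cons (.scan (.shift hc)) hp, ?_, ?_⟩
      · intro j
        by_cases hj : j = k
        · subst hj; simp [stack_cons, hc, hs]
        · simp [stack_cons, hj, hs]
      · intro j
        have := hn j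
        by_cases hj : j = k
        · subst hj; simp [blanks_cons, hc]; omega
        · simp only [List.map_cons, blanks_cons, Function.update_of_ne hj]; omega

theorem path_skip {q : Q} {k : K} {e : Bool} {next : Option G → Q}
    (hq : M.prog q = .read k e next) (row : List (K → Option G)) (hs : stack row k = []) :
    Path (RowEdge M x) (.inl (.scan (.find q))) (cellLetters (row.map fun c => (c, c)))
      (.inl (.scan (.find q))) := by
  induction row with
  | nil => exact .nil _
  | cons c row ih =>
    simp only [stack_cons, List.append_eq_nil_iff, Option.toList_eq_nil_iff] at hs
    exact .cons (.scan (.skip hq hs.1)) (ih hs.2)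

/-- The first cell with a symbol of the stack `k` holds its top. Erasing it leaves a blank, so a
read never uses up room. -/
theorem exists_path_find {q : Q} {k : K} {e : Bool} {next : Option G → Q}
    (hq : M.prog q = .read k e next) (row : List (K → Option G)) {g : G} {l : List G}
    (hs : stack row k = g :: l) : ∃ v, v.map Prod.fst = row ∧
      Path (RowEdge M x) (.inl (.scan (.find q))) (cellLetters v)
        (.inl (.scan (.ready (next (some g))))) ∧
      (∀ j, stack (v.map Prod.snd) j =
        if e then Function.update (stack row) k l j else stack row j) ∧
      ∀ j, blanks row j ≤ blanks (v.map Prod.snd) j := by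
  induction row with
  | nil => simp at hs
  | cons c row ih =>
    cases hc : c k with
    | none =>
      obtain ⟨v, hv, hp, hs', hn⟩ := ih (by simpa [stack_cons, hc] using hs)
      refine ⟨(c, c) :: v, by simp [hv], .cons (.scan (.skip hq hc)) hp, ?_, ?_⟩
      · intro j
        by_cases hj : j = k
        · subst hj; simp [stack_cons, hc, hs']
        · simp [stack_cons, hj, hs']
      · intro j
        simp only [List.map_cons, blanks_cons]
        have := hn j
        omega
    | some g' =>
      obtain ⟨rfl, hl⟩ : g' = g ∧ stack row k = l := by simpa [stack_cons, hc] using hs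
      refine ⟨(c, if e then Function.update c k none else c) :: row.map fun c => (c, c), ?_,
        .cons (.scan (.found hq hc)) (path_copy _ row), ?_, ?_⟩
      · simp [Function.comp_def]
      · intro j
        by_cases hj : j = k
        · subst hj; cases e <;> simp [stack_cons, hl, Function.comp_def]
        · cases e <;> simp [stack_cons, hj, Function.comp_def]
      · intro j
        simp only [List.map_cons, List.map_map, Function.comp_def, List.map_id', blanks_cons]
        by_cases hj : j = k
        · subst hj; simp [hc]
        · cases e <;> simp [hj]

/-- A computation that halts can be simulated in all sufficiently long rows. -/
theorem exists_path_of_reaches {c d : Q × (K → List G)}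
    (h : StateTransition.Reaches (Instr.step M.prog) c d) (hd : Instr.step M.prog d = none) :
    ∃ b, ∀ row : List (K → Option G), stack row = c.2 → (∀ k, b ≤ blanks row k) →
      ∃ u, Path (RowEdge M x) (.inl (.scan (.ready c.1))) u (.inl .acc) ∧
        u.map Prod.fst <+: .hash :: row.map .cell ++ u.map Prod.snd := by
  induction h using Relation.ReflTransGen.head_induction_on with
  | refl =>
    refine ⟨0, fun row _ _ => ⟨[(.hash, .hash)], .single (.halt ?_), by simp⟩⟩
    revert hd
    obtain ⟨q, S⟩ := d
    simp only [Instr.step]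
    cases M.prog q <;> simp
  | @head c c' hc _ ih =>
    obtain ⟨b, ih⟩ := ih
    -- One machine step uses up at most one blank in each stack.
    refine ⟨b + 1, fun row hr hb => ?_⟩
    obtain ⟨q, S⟩ := c
    obtain ⟨q', S'⟩ := c'
    obtain rfl : stack row = S := hr
    simp only [Instr.step, Option.mem_def] at hc
    cases hq : M.prog q with
    | halt => simp [hq] at hc
    | push k g q'' =>
      simp only [hq, Option.some.injEq, Prod.mk.injEq] at hc
      obtain ⟨rfl, rfl⟩ := hc
      obtain ⟨v, hv, hp, hs, hn⟩ := exists_path_carry (M := M) (x := x) k g q'' row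
        (by have := hb k; omega)
      obtain ⟨u, hu, hpre⟩ := ih (v.map Prod.snd)
        (by funext j; rw [hs]; by_cases hj : j = k <;> simp [hj])
        fun j => by have := hb j; have := hn j; omega
      refine ⟨(.hash, .hash) :: (cellLetters v ++ u), .cons (.scan (.push hq)) (hp.append hu), ?_⟩
      simpa [map_fst_cellLetters, map_snd_cellLetters, hv, List.prefix_append_right_inj] using hpre
    | read k e next =>
      simp only [hq, Option.some.injEq, Prod.mk.injEq] at hc
      obtain ⟨rfl, rfl⟩ := hc
      cases hs : stack row k with
      | nil =>
        obtain ⟨u, hu, hpre⟩ := ih row (by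
          funext j
          cases e
          · simp
          · by_cases hj : j = k
            · subst hj; simp [hs]
            · simp [hj]) fun j => by have := hb j; omega
        -- That a stack is empty is only known at the end of the row, so the row is passed twice:
        -- once in the search and once as a copy in the new control state.
        refine ⟨(.hash, .hash) :: (cellLetters (row.map fun c => (c, c)) ++
          (.hash, .hash) :: (cellLetters (row.map fun c => (c, c)) ++ u)),
          .cons (.scan (.read hq)) ((path_skip hq row hs).append
            (.cons (.scan (.empty hq)) ((path_copy _ row).append ?_))), ?_⟩
        · simpa [hs] using hu
        · simpa [map_fst_cellLetters, map_snd_cellLetters, Function.comp_def,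
            List.prefix_append_right_inj] using hpre
      | cons g l =>
        obtain ⟨v, hv, hp, hs', hn⟩ := exists_path_find (M := M) (x := x) hq row hs
        obtain ⟨u, hu, hpre⟩ := ih (v.map Prod.snd)
          (by funext j; rw [hs']; cases e <;> simp [hs])
          fun j => by have := hb j; have := hn j; omega
        refine ⟨(.hash, .hash) :: (cellLetters v ++ u),
          .cons (.scan (.read hq)) (hp.append (by simpa [hs] using hu)), ?_⟩
        simpa [map_fst_cellLetters, map_snd_cellLetters, hv, List.prefix_append_right_inj]
          using hpre

theorem path_pad (b : ℕ) : Path (RowEdge M x) (.inl .pad)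
    ((List.replicate b fun _ => none).map (fun c => (.hash, .cell c))) (.inl .pad) := by
  induction b with
  | zero => exact .nil _
  | succ b ih => exact .cons .pad ih

theorem path_cells {k : ℕ} (hk : k ≤ x) (b : ℕ) : Path (RowEdge M x) (.inr k)
    ((M.cells k b).map (fun c => (.hash, .cell c))) (.inl .pad) := by
  induction k with
  | zero => exact .cons .tail₁ (.cons .tail₂ (path_pad b))
  | succ k ih => exact .cons (.count hk) (ih (by omega))

theorem StackMachine.rowAccepts_of_halts (h : Instr.Halts M.prog M.q₀ (M.input x)) :
    M.RowAccepts x := by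
  obtain ⟨d, hd⟩ := Part.dom_iff_mem.1 h
  obtain ⟨hr, hn⟩ := StateTransition.mem_eval.1 hd
  obtain ⟨b, hb⟩ := exists_path_of_reaches (M := M) (x := x) hr hn
  obtain ⟨u, hu, hp⟩ := hb (M.cells x b) (M.stack_cells x b) fun k => by
    simp only [StackMachine.cells, blanks, List.countP_append, List.countP_cons,
      List.countP_replicate]
    simp
    omega
  -- The delay is the length of the first row, that is, its marker and its cells. The symbols read
  -- in this row are dummies, since the first `N` reads are unconstrained.
  refine ⟨(.hash, .first) :: ((M.cells x b).map (fun c => (.hash, .cell c)) ++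
    (.first, .hash) :: (cellLetters ((M.cells x b).map fun c => (c, c)) ++ u)),
    .cons .start ((path_cells le_rfl b).append (.cons .enter ((path_copy _ _).append hu))),
    (M.cells x b).length + 1, ?_, ?_, ?_⟩
  · simp [StackMachine.cells]; omega
  · simp
  · rw [List.drop_succ_cons, List.drop_left' (by simp)]
    simpa [map_fst_cellLetters, map_snd_cellLetters, Function.comp_def,
      List.prefix_append_right_inj] using hp

theorem StackMachine.rowAccepts_iff_halts :
    M.RowAccepts x ↔ Instr.Halts M.prog M.q₀ (M.input x) :=
  ⟨RowAccepts.halts, rowAccepts_of_halts⟩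

end Simulation

/-! ### The model -/

/-- The marks on the words that test the timestamps of a computation: `ge₁` and `ge₂` (`lt₁` and
`lt₂`) enclose a segment that may last at least (less than) one unit of time, and `both` and
`claim` also carry a symbol. -/
inductive Mark (K G : Type)
  | none
  | ge₁
  | ge₂
  | lt₁
  | lt₂
  | both (s : Sym K G)
  | claim (s : Sym K G)

section Marks

variable {K G : Type}

/-- The four marks go to positions `i`, `i + 1`, `j`, `j + 1`. In `fwd` and `bwd` the kinds of the
two segments from `i` to `j` and from `i + 1` to `j + 1` are opposite, so that the disjunction of
both tests reads as an implication. In `copy s` the mark `both s` starts a segment of either kind,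
one ending at `j` and one at `j + 1`; both tests fail precisely when `j + 1` is the first position
at distance at least 1 from `i`. -/
def Pattern.m₁ : Pattern K G → Mark K G
  | gap => .lt₁
  | fwd => .lt₁
  | bwd => .ge₁
  | copy s => .both s

def Pattern.m₂ : Pattern K G → Mark K G
  | gap => .none
  | fwd => .ge₁
  | bwd => .lt₁
  | copy _ => .none

def Pattern.m₃ : Pattern K G → Mark K G
  | gap => .lt₂
  | fwd => .lt₂
  | bwd => .ge₂
  | copy _ => .ge₂

def Pattern.m₄ : Pattern K G → Mark K G
  | gap => .none
  | fwd => .ge₂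
  | bwd => .lt₂
  | copy s => .claim s

/-- The edges for the words of marks. -/
inductive MarkEdge {Q : Type} : Loc K G Q → Mark K G → Loc K G Q → Prop
  | start_idle : MarkEdge .start .none .idle
  | start (p : Pattern K G) : MarkEdge .start p.m₁ (.mark₁ p)
  | start_whole : MarkEdge .start .ge₁ .whole
  | idle : MarkEdge .idle .none .idle
  | first (p : Pattern K G) : MarkEdge .idle p.m₁ (.mark₁ p)
  | second (p : Pattern K G) : MarkEdge (.mark₁ p) p.m₂ (.mark₂ p)
  | wait {p : Pattern K G} : p ≠ .gap → MarkEdge (.mark₂ p) .none (.mark₂ p)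
  | third (p : Pattern K G) : MarkEdge (.mark₂ p) p.m₃ (.mark₃ p)
  | fourth (p : Pattern K G) : MarkEdge (.mark₃ p) p.m₄ .fin
  | fin : MarkEdge .fin .none .fin
  | whole : MarkEdge .whole .none .whole
  | last : MarkEdge .whole .ge₂ .acc

end Marks

section Finiteness

variable {K G Q : Type} [Finite K] [Finite G] [Finite Q]

instance : Finite (Sym K G) :=
  Finite.of_injective (β := Option (Option (K → Option G)))
    (fun | .hash => none | .first => some none | .cell c => some (some c))
    (by rintro (_ | _ | _) (_ | _ | _) <;> simp)

instance : Finite (Scan K G Q) :=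
  Finite.of_injective (β := Q ⊕ (K × G × Q) ⊕ Q)
    (fun | .ready q => .inl q | .carry k g q => .inr (.inl (k, g, q)) | .find q => .inr (.inr q))
    (by rintro (_ | _ | _) (_ | _ | _) <;> simp)

instance : Finite (Pattern K G) :=
  Finite.of_injective (β := Fin 3 ⊕ Sym K G)
    (fun | .gap => .inl 0 | .fwd => .inl 1 | .bwd => .inl 2 | .copy s => .inr s)
    (by rintro (_ | _ | _ | _) (_ | _ | _ | _) <;> simp)

instance : Finite (Mark K G) :=
  Finite.of_injective (β := Fin 5 ⊕ Sym K G ⊕ Sym K G)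
    (fun | .none => .inl 0 | .ge₁ => .inl 1 | .ge₂ => .inl 2 | .lt₁ => .inl 3 | .lt₂ => .inl 4
         | .both s => .inr (.inl s) | .claim s => .inr (.inr s))
    (by rintro (_ | _ | _ | _ | _ | _ | _) (_ | _ | _ | _ | _ | _ | _) <;> simp)

instance : Finite (Loc K G Q) :=
  Finite.of_injective (β := Fin 10 × Option (Scan K G Q) × Option (Pattern K G))
    (fun
      | .start => (0, none, none)
      | .acc => (1, none, none)
      | .tail => (2, none, none)
      | .pad => (3, none, none)
      | .scan s => (0, some s, none)
      | .idle => (4, none, none)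
      | .mark₁ p => (0, none, some p)
      | .mark₂ p => (1, none, some p)
      | .mark₃ p => (2, none, some p)
      | .fin => (5, none, none)
      | .whole => (6, none, none))
    (by
      rintro (_ | _ | _ | _ | _ | _ | _ | _ | _ | _ | _)
        (_ | _ | _ | _ | _ | _ | _ | _ | _ | _ | _) <;> simp)

end Finiteness

section Model

variable {K G Q : Type}

section Symbols

variable [Finite K] [Finite G]

/-- A number for each symbol. -/
noncomputable def Sym.index (s : Sym K G) : ℕ := Finite.equivFin (Sym K G) s

theorem Sym.index_lt (s : Sym K G) : s.index < Nat.card (Sym K G) := (Finite.equivFin _ s).2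

theorem Sym.index_injective : Function.Injective (Sym.index (K := K) (G := G)) :=
  fun _ _ h => (Finite.equivFin _).injective (Fin.ext h)

/-- The proposition that claims that `s` is written. -/
noncomputable def Sym.written (s : Sym K G) : ℕ := 5 + 2 * s.index

/-- The proposition that claims that `s` is read. -/
noncomputable def Sym.read (s : Sym K G) : ℕ := 6 + 2 * s.index

variable (K G) in
/-- The number of atomic propositions. -/
noncomputable def numProps : ℕ := 5 + 2 * Nat.card (Sym K G)

theorem Sym.written_lt (s : Sym K G) : s.written < numProps K G := by
  have := s.index_lt
  simp only [written, numProps]; omega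

theorem Sym.read_lt (s : Sym K G) : s.read < numProps K G := by
  have := s.index_lt
  simp only [read, numProps]; omega

/-- The propositions that hold in the letter `(r, w)` of a computation. -/
noncomputable def rowProps (a : Sym K G × Sym K G) : List ℕ := [0, a.1.read, a.2.written]

/-- The propositions that hold in a mark. -/
noncomputable def Mark.props : Mark K G → List ℕ
  | none => []
  | ge₁ => [1]
  | ge₂ => [2]
  | lt₁ => [3]
  | lt₂ => [4]
  | both s => [1, 3, s.written]
  | claim s => [4, s.read]

noncomputable def letterProps : (Sym K G × Sym K G) ⊕ Mark K G → List ℕ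
  | .inl a => rowProps a
  | .inr μ => μ.props

theorem letterProps_lt (l : (Sym K G × Sym K G) ⊕ Mark K G) :
    ∀ p ∈ letterProps l, p < numProps K G := by
  have h5 : 5 ≤ numProps K G := Nat.le_add_right _ _
  rcases l with ⟨r, w⟩ | μ
  · simp [letterProps, rowProps, Sym.read_lt, Sym.written_lt]; omega
  · cases μ <;> simp [letterProps, Mark.props, Sym.read_lt, Sym.written_lt] <;> omega

end Symbols

section Locations

variable [Finite K] [Finite G] [Finite Q]

/-- The number of a location of the model. -/
noncomputable def locNum : Loc K G Q ⊕ ℕ → ℕ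
  | .inl a => Finite.equivFin (Loc K G Q) a
  | .inr k => Nat.card (Loc K G Q) + k

theorem locNum_injective : Function.Injective (locNum (K := K) (G := G) (Q := Q)) := by
  rintro (a | k) (b | l) h <;> simp only [locNum] at h
  · rw [(Finite.equivFin _).injective (Fin.ext h)]
  · have := (Finite.equivFin _ a).2; omega
  · have := (Finite.equivFin _ b).2; omega
  · rw [Nat.add_left_cancel h]

theorem locNum_inl_lt (a : Loc K G Q) : locNum (.inl a) < Nat.card (Loc K G Q) :=
  (Finite.equivFin _ a).2

theorem locNum_inl_lt' (x : ℕ) (a : Loc K G Q) :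
    locNum (.inl a) < Nat.card (Loc K G Q) + (x + 1) :=
  (locNum_inl_lt a).trans_le (Nat.le_add_right _ _)

/-- The transition of the model for an edge. -/
noncomputable def edgeTrans (s : Loc K G Q ⊕ ℕ) (l : (Sym K G × Sym K G) ⊕ Mark K G)
    (t : Loc K G Q ⊕ ℕ) : Transition ℕ :=
  ⟨locNum s, letterProps l, [], [], locNum t⟩

end Locations

variable [DecidableEq K]

/-- The edges of the model. -/
inductive ModelEdge (M : StackMachine K G Q) (x : ℕ) :
    Loc K G Q ⊕ ℕ → (Sym K G × Sym K G) ⊕ Mark K G → Loc K G Q ⊕ ℕ → Prop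
  | row {s t : Loc K G Q ⊕ ℕ} {a : Sym K G × Sym K G} : RowEdge M x s a t →
      ModelEdge M x s (.inl a) t
  | mark {s t : Loc K G Q} {μ : Mark K G} : MarkEdge s μ t →
      ModelEdge M x (.inl s) (.inr μ) (.inl t)

section Paths

variable {M : StackMachine K G Q} {x : ℕ}

/-- Computations and words of marks share only the location `start`, which is never entered again,
and `acc`, which is never left. The first edge therefore decides the kind of the whole word. -/
theorem path_row_of_path {ls : List ((Sym K G × Sym K G) ⊕ Mark K G)} {s t : Loc K G Q ⊕ ℕ}
    (h : Path (ModelEdge M x) s ls t) (hs : ∀ a : Loc K G Q, s = .inl a →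
      a = .acc ∨ a = .tail ∨ a = .pad ∨ ∃ c, a = .scan c) :
    t ≠ .inl .fin ∧ ∃ u, ls = u.map .inl ∧ Path (RowEdge M x) s u t := by
  induction h with
  | nil =>
    refine ⟨?_, [], rfl, .nil _⟩
    rintro rfl
    have := hs _ rfl
    simp at this
  | cons he _ ih =>
    cases he with
    | @row s t a he =>
      obtain ⟨ht, u, rfl, hu⟩ := ih (by cases he <;> simp)
      exact ⟨ht, a :: u, rfl, .cons he hu⟩
    | mark he =>
      have := hs _ rfl
      cases he <;> simp at this

theorem path_mark_of_path {ls : List ((Sym K G × Sym K G) ⊕ Mark K G)} {s : Loc K G Q}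
    {t : Loc K G Q ⊕ ℕ} (h : Path (ModelEdge M x) (.inl s) ls t)
    (hs : s ≠ .start ∧ s ≠ .tail ∧ s ≠ .pad ∧ ∀ c, s ≠ .scan c) :
    ∃ b t', t = .inl t' ∧ ls = b.map .inr ∧ Path MarkEdge s b t' := by
  generalize hs' : (Sum.inl s : Loc K G Q ⊕ ℕ) = s' at h
  induction h generalizing s with
  | nil => exact ⟨[], s, hs'.symm, rfl, .nil _⟩
  | cons he _ ih =>
    cases he with
    | row he => subst hs'; cases he <;> simp at hs
    | @mark s₁ t₁ μ he =>
      obtain rfl : s = s₁ := Sum.inl_injective hs'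
      obtain ⟨b, t', rfl, rfl, hb⟩ := ih (s := t₁) (by cases he <;> simp) rfl
      exact ⟨μ :: b, t', rfl, rfl, .cons he hb⟩

theorem Path.map_edge {α β γ δ : Type} {E : α → β → α → Prop} {F : γ → δ → γ → Prop} (f : α → γ)
    (g : β → δ) (hEF : ∀ s a t, E s a t → F (f s) (g a) (f t)) {s t : α} {w : List β}
    (h : Path E s w t) : Path F (f s) (w.map g) (f t) := by
  induction h with
  | nil => exact .nil _
  | cons he _ ih => exact .cons (hEF _ _ _ he) ih

end Paths

variable [Finite K] [Finite G] [Finite Q]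

/-- The transitions of the model that do not depend on the input. -/
noncomputable def fixedTrans (M : StackMachine K G Q) : List (Transition ℕ) :=
  edgeTrans (K := K) (G := G) (Q := Q) (.inr 0) (.inl (.hash, .cell (M.single M.t₁)))
      (.inl .tail) ::
    (Set.toFinite {e : Loc K G Q × ((Sym K G × Sym K G) ⊕ Mark K G) × Loc K G Q |
      ModelEdge M 0 (.inl e.1) e.2.1 (.inl e.2.2)}).toFinset.toList.map
        fun e => edgeTrans (.inl e.1) e.2.1 (.inl e.2.2)

/-- The model for the input `x`. -/
noncomputable def model (M : StackMachine K G Q) (x : ℕ) : TA ℕ where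
  locs := Nat.card (Loc K G Q) + (x + 1)
  init := locNum (K := K) (G := G) (Q := Q) (.inl .start)
  clocks := 0
  trans := fixedTrans M ++
    (edgeTrans (K := K) (G := G) (Q := Q) (.inl .start) (.inl (.hash, .first)) (.inr x) ::
    (List.range x).map fun k => edgeTrans (K := K) (G := G) (Q := Q) (.inr (k + 1))
      (.inl (.hash, .cell (M.single M.z))) (.inr k))
  acc := [locNum (K := K) (G := G) (Q := Q) (.inl .acc),
    locNum (K := K) (G := G) (Q := Q) (.inl .fin)]

variable {M : StackMachine K G Q} {x : ℕ}

/-! ### The words accepted by the model -/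

theorem mem_model_trans {e : Transition ℕ} :
    e ∈ (model M x).trans ↔ ∃ s l t, ModelEdge M x s l t ∧ e = edgeTrans s l t := by
  simp only [model, fixedTrans, List.cons_append, List.mem_cons, List.mem_append, List.mem_map,
    Finset.mem_toList, Set.Finite.mem_toFinset, Set.mem_ofPred_eq, List.mem_range]
  constructor
  · rintro (rfl | ⟨⟨s, l, t⟩, h, rfl⟩ | rfl | ⟨k, hk, rfl⟩)
    · exact ⟨_, _, _, .row .tail₁, rfl⟩
    · refine ⟨.inl s, l, .inl t, ?_, rfl⟩
      cases h with
      | row h =>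
        -- Edges between fixed locations do not depend on the input, so those listed for the input
        -- `0` are edges for every `x`.
        refine .row ?_
        dsimp only at h
        cases h <;> constructor <;> assumption
      | mark h => exact .mark h
    · exact ⟨_, _, _, .row .start, rfl⟩
    · exact ⟨_, _, _, .row (.count hk), rfl⟩
  · rintro ⟨s, l, t, h, rfl⟩
    cases h with
    | row h =>
      cases h with
      | start => exact .inr (.inr (.inl rfl))
      | count hk => exact .inr (.inr (.inr ⟨_, hk, rfl⟩))
      | tail₁ => exact .inl rfl
      | tail₂ => exact .inr (.inl ⟨(_, _, _), .row .tail₂, rfl⟩)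
      | pad => exact .inr (.inl ⟨(_, _, _), .row .pad, rfl⟩)
      | enter => exact .inr (.inl ⟨(_, _, _), .row .enter, rfl⟩)
      | scan h => exact .inr (.inl ⟨(_, _, _), .row (.scan h), rfl⟩)
      | halt h => exact .inr (.inl ⟨(_, _, _), .row (.halt h), rfl⟩)
    | mark h => exact .inr (.inl ⟨(_, _, _), .mark h, rfl⟩)

theorem RowEdge.locNum_lt {s t : Loc K G Q ⊕ ℕ} {a : Sym K G × Sym K G} (h : RowEdge M x s a t) :
    locNum s < Nat.card (Loc K G Q) + (x + 1) ∧ locNum t < Nat.card (Loc K G Q) + (x + 1) := by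
  cases h <;> refine ⟨?_, ?_⟩ <;> first | exact locNum_inl_lt' x _ | (simp only [locNum]; omega)

theorem model_wellFormed : (model M x).WellFormed {p | p < numProps K G} := by
  have hlt : ∀ {s l t}, ModelEdge M x s l t → locNum s < Nat.card (Loc K G Q) + (x + 1) ∧
      locNum t < Nat.card (Loc K G Q) + (x + 1) := by
    intro s l t h
    cases h with
    | row h => exact h.locNum_lt
    | mark h => exact ⟨locNum_inl_lt' x _, locNum_inl_lt' x _⟩
  constructor
  · exact locNum_inl_lt' x _
  · intro s hs
    simp only [model, List.mem_cons, List.not_mem_nil, or_false] at hs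
    rcases hs with rfl | rfl <;> exact locNum_inl_lt' x _
  · intro e he
    obtain ⟨s, l, t, h, rfl⟩ := mem_model_trans.1 he
    exact (hlt h).1
  · intro e he
    obtain ⟨s, l, t, h, rfl⟩ := mem_model_trans.1 he
    exact (hlt h).2
  · intro e he
    obtain ⟨s, l, t, h, rfl⟩ := mem_model_trans.1 he
    exact letterProps_lt l
  · intro e he
    obtain ⟨s, l, t, h, rfl⟩ := mem_model_trans.1 he
    simp [edgeTrans]
  · intro e he
    obtain ⟨s, l, t, h, rfl⟩ := mem_model_trans.1 he
    simp [edgeTrans]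

theorem exists_path_of_run {n n' : ℕ} {v v' : ℕ → ℝ≥0} {τ : ℝ≥0} {w : List (Finset ℕ × ℝ≥0)}
    (h : (model M x).Run n v τ w n' v') (s : Loc K G Q ⊕ ℕ) (hs : n = locNum s) :
    ∃ ls t, n' = locNum t ∧ Path (ModelEdge M x) s ls t ∧
      w.map Prod.fst = ls.map fun l => (letterProps l).toFinset := by
  induction h generalizing s with
  | nil => exact ⟨[], s, hs, .nil s, rfl⟩
  | cons e v v₁ v' τ τ₁ σ w n' mem reads enabled resets rest ih =>
    obtain ⟨s', l, t, he, rfl⟩ := mem_model_trans.1 mem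
    obtain rfl : s' = s := locNum_injective hs
    obtain ⟨ls, t', hn, hp, hw⟩ := ih t rfl
    refine ⟨l :: ls, t', hn, .cons he hp, ?_⟩
    simp only [List.map_cons, hw, List.cons.injEq, and_true]
    ext p
    rw [reads p]
    simp [edgeTrans]

theorem exists_run_of_path {s t : Loc K G Q ⊕ ℕ} {ls : List ((Sym K G × Sym K G) ⊕ Mark K G)}
    (h : Path (ModelEdge M x) s ls t) (v : ℕ → ℝ≥0) (τ : ℝ≥0) (w : List (Finset ℕ × ℝ≥0))
    (hw : w.map Prod.fst = ls.map fun l => (letterProps l).toFinset) :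
    ∃ v', (model M x).Run (locNum s) v τ w (locNum t) v' := by
  induction h generalizing v τ w with
  | nil =>
    obtain rfl : w = [] := by simpa using hw
    exact ⟨v, .nil _ _ _⟩
  | @cons s t u l ls he _ ih =>
    cases w with
    | nil => simp at hw
    | cons e w =>
      simp only [List.map_cons, List.cons.injEq] at hw
      obtain ⟨v', hv'⟩ := ih (fun y => v y + (e.2 - τ)) e.2 w hw.2
      refine ⟨v', .cons (edgeTrans s l t) v _ v' τ e.2 e.1 w _ (mem_model_trans.2 ⟨_, _, _, he, rfl⟩)
        ?_ (by simp [edgeTrans, Guard.Holds]) (by simp [edgeTrans]) hv'⟩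
      intro p
      simp [hw.1, edgeTrans]

variable (M x) in
/-- The words of computations with input `x`. -/
def IsRow (w : List (Finset ℕ)) : Prop :=
  ∃ u, Path (RowEdge M x) (.inl .start) u (.inl .acc) ∧ w = u.map fun a => (rowProps a).toFinset

variable (K G Q) in
/-- The words of marks. -/
def IsMarking (w : List (Finset ℕ)) : Prop :=
  ∃ b, (Path (MarkEdge (K := K) (G := G) (Q := Q)) .start b .acc ∨
    Path (MarkEdge (K := K) (G := G) (Q := Q)) .start b .fin) ∧
    w = b.map fun μ => μ.props.toFinset

/-- The model accepts the words of computations and those of marks, at arbitrary times. -/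
theorem mem_model_language {ρ : TimedWord ℕ} : ρ ∈ (model M x).language ↔
    IsRow M x (ρ.events.map Prod.fst) ∨ IsMarking K G Q (ρ.events.map Prod.fst) := by
  constructor
  · rintro ⟨n, v, hn, hr⟩
    obtain ⟨ls, t, rfl, hp, hw⟩ := exists_path_of_run hr (.inl .start) rfl
    replace hn : t = .inl .acc ∨ t = .inl .fin := by
      simpa [model, locNum_injective.eq_iff] using hn
    rw [hw]
    cases hp with
    | nil => simp at hn
    | cons he hp =>
      cases he with
      | @row _ s a he =>
        obtain ⟨hf, u, rfl, hu⟩ := path_row_of_path hp (by cases he; simp)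
        obtain rfl := hn.resolve_right hf
        exact .inl ⟨a :: u, .cons he hu, by simp [letterProps]⟩
      | @mark _ s μ he =>
        obtain ⟨b, t', rfl, rfl, hb⟩ := path_mark_of_path hp (by cases he <;> simp)
        refine .inr ⟨μ :: b, ?_, by simp [letterProps]⟩
        rcases hn with hn | hn <;> cases hn
        · exact .inl (.cons he hb)
        · exact .inr (.cons he hb)
  · rintro (⟨u, hu, hw⟩ | ⟨b, hb, hw⟩)
    · obtain ⟨v, hv⟩ := exists_run_of_path (hu.map_edge id .inl fun _ _ _ h => ModelEdge.row h)
        (fun _ => 0) 0 ρ.events (by rw [hw]; simp [letterProps])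
      exact ⟨_, v, by simp [model], hv⟩
    · rcases hb with hb | hb <;>
      · obtain ⟨v, hv⟩ := exists_run_of_path (M := M) (x := x)
          (hb.map_edge .inl .inr fun _ _ _ h => ModelEdge.mark h)
          (fun _ => 0) 0 ρ.events (by rw [hw]; simp [letterProps])
        exact ⟨_, v, by simp [model], hv⟩

end Model

/-! ### The specification -/

theorem TimedWord.letter_unique {P : Type} (ρ : TimedWord P) {σ σ' : Finset P} {t : ℝ≥0}
    (h : (σ, t) ∈ ρ.events) (h' : (σ', t) ∈ ρ.events) : σ = σ' := by
  have hp := List.pairwise_map.1 ρ.increasing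
  by_contra hne
  have key : ∀ a ∈ ρ.events, ∀ b ∈ ρ.events, a.2 = b.2 → a = b := by
    intro a ha b hb hab
    obtain ⟨i, hi, rfl⟩ := List.getElem_of_mem ha
    obtain ⟨j, hj, rfl⟩ := List.getElem_of_mem hb
    rcases lt_trichotomy i j with hij | rfl | hij
    · exact absurd hab (List.pairwise_iff_getElem.1 hp i j hi hj hij).ne
    · rfl
    · exact absurd hab (List.pairwise_iff_getElem.1 hp j i hj hi hij).ne'
  exact hne (congrArg Prod.fst (key _ h _ h' rfl))

namespace QF

/-- Disjunction. -/
def disj (a b : QF) : QF := neg (conj (neg a) (neg b))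

/-- Disjunction of a list. -/
def bigDisj : List QF → QF
  | [] => neg top
  | a :: l => disj a (bigDisj l)

/-- `a` holds at some later event, at a distance in `I`. -/
def fut (I : Interval) (a : QF) : QF := untl I top a

end QF

/-- `[0, ∞)` -/
def Interval.univ : Interval := ⟨0, none, true, false, by simp⟩

/-- `[1, ∞)` -/
def Interval.ge : Interval := ⟨1, none, true, false, by simp⟩

/-- `[0, 1)` -/
def Interval.lt : Interval := ⟨0, some 1, true, false, by simp⟩

/-! ### Satisfaction of the derived connectives -/

section Semantics

variable {A : Assignment} {t : ℝ≥0}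

theorem QF.sat_disj {a b : QF} : (disj a b).Sat A true t ↔ a.Sat A true t ∨ b.Sat A true t :=
  Iff.rfl

/-- The empty disjunction is `¬ ⊤`, which is true exactly where there is no event; hence the
restriction to times of events. -/
theorem QF.sat_bigDisj {l : List QF} (ht : A.OccursAt t) :
    (bigDisj l).Sat A true t ↔ ∃ a ∈ l, a.Sat A true t := by
  induction l with
  | nil => simp [bigDisj, QF.Sat, ht]
  | cons a l ih =>
    rw [bigDisj, QF.sat_disj, ih]
    simp

theorem QF.sat_fut {I : Interval} {a : QF} : (fut I a).Sat A true t ↔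
    ∃ t', t < t' ∧ I.Mem ((t' : ℝ) - t) ∧ A.OccursAt t' ∧ a.Sat A true t' := by
  simp only [fut, QF.Sat]
  constructor
  · rintro ⟨t', h1, h2, h3, h4, -⟩
    exact ⟨t', h1, h2, h3, h4⟩
  · rintro ⟨t', h1, h2, h3, h4⟩
    exact ⟨t', h1, h2, h3, h4, fun _ _ _ h => h⟩

theorem Interval.mem_univ {t' : ℝ≥0} (h : t < t') : Interval.univ.Mem ((t' : ℝ) - t) := by
  have : (t : ℝ) < t' := h
  simpa [Interval.univ, Interval.Mem] using this.le

theorem Interval.mem_ge {t' : ℝ≥0} : Interval.ge.Mem ((t' : ℝ) - t) ↔ t + 1 ≤ t' := by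
  rw [← NNReal.coe_le_coe]
  simp [Interval.ge, Interval.Mem, le_sub_iff_add_le, add_comm]

theorem Interval.mem_lt {t' : ℝ≥0} (h : t < t') :
    Interval.lt.Mem ((t' : ℝ) - t) ↔ t' < t + 1 := by
  have : (t : ℝ) < t' := h
  rw [← NNReal.coe_lt_coe]
  simp [Interval.lt, Interval.Mem, this.le, sub_lt_iff_lt_add, add_comm]

/-- All the traces of `V` have an event whenever some trace does. -/
def Assignment.Synced (A : Assignment) (V : Set ℕ) : Prop :=
  ∀ t, A.OccursAt t → ∀ x ∈ V, ∃ ρ, A x = some ρ ∧ ρ.OccursAt t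

/-- A negated atom also demands an event of its trace. For synchronised traces there is one, with a
unique letter, and the negation is the classical one. -/
theorem QF.sat_neg_atom {V : Set ℕ} (hA : A.Synced V) (ht : A.OccursAt t) {p x : ℕ} (hx : x ∈ V) :
    (neg (atom p x)).Sat A true t ↔ ¬ (atom p x).Sat A true t := by
  obtain ⟨ρ, hρ, σ, hσ⟩ := hA t ht x hx
  simp only [QF.Sat]
  constructor
  · rintro ⟨ρ', h1, σ', h2, h3⟩ ⟨ρ'', h4, σ'', h5, h6⟩
    obtain rfl : ρ' = ρ'' := Option.some_injective _ (h1.symm.trans h4)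
    rw [ρ'.letter_unique h2 h5] at h3
    exact h3 h6
  · intro h
    exact ⟨ρ, hρ, σ, hσ, fun hp => h ⟨ρ, hρ, σ, hσ, hp⟩⟩

end Semantics

/-- The condition, on the letters of the traces `0` and `1`, under which a test succeeds at once.
The letter of the trace `x` consists of the propositions `p` with `m p x`. -/
def Escape (N : ℕ) (m : ℕ → ℕ → Prop) : Prop :=
  m 0 0 ∧ (m 0 1 ∨ ∃ i < N, (m (5 + 2 * i) 1 ∧ ¬ m (5 + 2 * i) 0) ∨
    (m (6 + 2 * i) 1 ∧ m (6 + 2 * i) 0))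

/-- Negated atoms occur for the trace `0` only, so this is the only trace that has to be
synchronised when satisfaction is evaluated. -/
def escape (N : ℕ) : QF :=
  .conj (.atom 0 0) (.disj (.atom 0 1) (.bigDisj ((List.range N).map fun i =>
    .disj (.conj (.atom (5 + 2 * i) 1) (.neg (.atom (5 + 2 * i) 0)))
      (.conj (.atom (6 + 2 * i) 1) (.atom (6 + 2 * i) 0)))))

/-- The tests of the distance of two marked events. -/
def test (N : ℕ) : QF :=
  .conj (.neg .top) (.disj (.fut .univ (escape N)) (.disj
    (.fut .univ (.conj (.conj (.atom 0 0) (.atom 1 1)) (.fut .ge (.atom 2 1))))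
    (.fut .univ (.conj (.conj (.atom 0 0) (.atom 3 1)) (.fut .lt (.atom 4 1))))))

/-- The specification. -/
def spec (N : ℕ) : Formula := .ex 0 (.all 1 (.all 2 (.qf (test N))))

theorem QF.over_bigDisj {D V : Set ℕ} {l : List QF} (h : ∀ a ∈ l, a.Over D V) :
    (bigDisj l).Over D V := by
  induction l with
  | nil => trivial
  | cons a l ih =>
    exact ⟨h a (by simp), ih fun b hb => h b (by simp [hb])⟩

theorem spec_closedOver (N : ℕ) : (spec N).ClosedOver {p | p < 5 + 2 * N} := by
  refine ⟨by simp [spec, Formula.vars], ?_⟩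
  have h : (escape N).Over {p | p < 5 + 2 * N} {x | x ∈ (spec N).vars} := by
    refine ⟨⟨?_, ?_⟩, ⟨?_, ?_⟩, QF.over_bigDisj ?_⟩
    · simp
    · simp [spec, Formula.vars]
    · simp
    · simp [spec, Formula.vars]
    · intro a ha
      obtain ⟨i, hi, rfl⟩ := List.mem_map.1 ha
      have := List.mem_range.1 hi
      simp only [QF.disj, QF.Over, spec, Formula.vars, Set.mem_ofPred_eq]
      simp
      omega
  simp only [spec, Formula.matrix, test, QF.disj, QF.fut, QF.Over, true_and]
  refine ⟨h, ?_⟩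
  simp [Formula.vars]
  omega

/-- `T` is the set of times of the events and `m t` describes the letters at the time `t`. -/
def Passes (N : ℕ) (T : Set ℝ≥0) (m : ℝ≥0 → ℕ → ℕ → Prop) : Prop :=
  ∃ t ∈ T, Escape N (m t) ∨ ((m t 0 0 ∧ m t 1 1) ∧ ∃ t' ∈ T, t + 1 ≤ t' ∧ m t' 2 1) ∨
    ((m t 0 0 ∧ m t 3 1) ∧ ∃ t' ∈ T, t < t' ∧ t' < t + 1 ∧ m t' 4 1)

theorem sat_escape {A : Assignment} {t : ℝ≥0} {N : ℕ} (hA : A.Synced {0}) (ht : A.OccursAt t) :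
    (escape N).Sat A true t ↔ Escape N fun p x => (QF.atom p x).Sat A true t := by
  simp only [escape, QF.Sat.eq_7, QF.sat_disj, QF.sat_bigDisj ht, Escape, List.mem_map,
    List.mem_range]
  refine and_congr_right fun _ => or_congr_right ?_
  constructor
  · rintro ⟨_, ⟨i, hi, rfl⟩, h⟩
    refine ⟨i, hi, ?_⟩
    rw [QF.sat_disj] at h
    exact h.imp (fun h => ⟨h.1, (QF.sat_neg_atom hA ht rfl).1 h.2⟩) id
  · rintro ⟨i, hi, h⟩
    refine ⟨_, ⟨i, hi, rfl⟩, ?_⟩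
    rw [QF.sat_disj]
    exact h.imp (fun h => ⟨h.1, (QF.sat_neg_atom hA ht rfl).2 h.2⟩) id

/-- The conjunct `¬ ⊤` forbids an event at time `0`, so the strict operator `fut`, evaluated at `0`,
overlooks no event. -/
theorem sat_test {A : Assignment} {N : ℕ} (hA : A.Synced {0}) : (test N).Sat A true 0 ↔
    ¬ A.OccursAt 0 ∧ Passes N {t | A.OccursAt t} fun t p x => (QF.atom p x).Sat A true t := by
  change ¬ A.OccursAt 0 ∧ QF.Sat A _ true 0 ↔ _
  refine and_congr_right fun h0 => ?_
  have hpos : ∀ {t}, A.OccursAt t → 0 < t := fun {t} ht =>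
    pos_iff_ne_zero.2 fun h => h0 (h ▸ ht)
  have hF : ∀ a : QF, (QF.fut .univ a).Sat A true 0 ↔ ∃ t, A.OccursAt t ∧ a.Sat A true t := by
    intro a
    rw [QF.sat_fut]
    constructor
    · rintro ⟨t, -, -, h1, h2⟩
      exact ⟨t, h1, h2⟩
    · rintro ⟨t, h1, h2⟩
      exact ⟨t, hpos h1, Interval.mem_univ (hpos h1), h1, h2⟩
  rw [QF.sat_disj, QF.sat_disj, hF, hF, hF, ← exists_or, ← exists_or]
  refine exists_congr fun t => ?_
  rw [← and_or_left, ← and_or_left]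
  refine and_congr_right fun ht => ?_
  rw [sat_escape hA ht]
  refine or_congr_right (or_congr (and_congr_right fun _ => ?_) (and_congr_right fun _ => ?_))
  · rw [QF.sat_fut]
    refine exists_congr fun t' => ?_
    rw [Interval.mem_ge]
    constructor
    · rintro ⟨-, h1, h2, h3⟩
      exact ⟨h2, h1, h3⟩
    · rintro ⟨h2, h1, h3⟩
      exact ⟨(lt_add_one t).trans_le h1, h1, h2, h3⟩
  · rw [QF.sat_fut]
    refine exists_congr fun t' => ?_
    constructor
    · rintro ⟨h, h1, h2, h3⟩
      exact ⟨h2, h, (Interval.mem_lt h).1 h1, h3⟩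
    · rintro ⟨h2, h, h1, h3⟩
      exact ⟨h, (Interval.mem_lt h).2 h1, h2, h3⟩

/-! ### The metric interval automaton for the specification -/

/-- A family of transitions: one for each letter that satisfies `cond`. -/
structure Rule where
  src : ℕ
  cond : (ℕ → ℕ → Prop) → Prop
  guard : Guard
  reset : List ℕ
  dst : ℕ

/-- In the location `1` the automaton waits for the start of a test, in `2` and `3` it has reset the
clock and waits for the end of the test. In the initial location `0` it also checks that the first
event does not happen at time `0`. -/
def miaRules (N : ℕ) : List Rule :=
  [⟨0, fun _ => True, [⟨0, .gt, 0⟩], [0], 1⟩,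
   ⟨0, Escape N, [⟨0, .gt, 0⟩], [0], 4⟩,
   ⟨0, fun m => m 0 0 ∧ m 1 1, [⟨0, .gt, 0⟩], [0], 2⟩,
   ⟨0, fun m => m 0 0 ∧ m 3 1, [⟨0, .gt, 0⟩], [0], 3⟩,
   ⟨1, fun _ => True, [], [], 1⟩,
   ⟨1, Escape N, [], [], 4⟩,
   ⟨1, fun m => m 0 0 ∧ m 1 1, [], [0], 2⟩,
   ⟨1, fun m => m 0 0 ∧ m 3 1, [], [0], 3⟩,
   ⟨2, fun _ => True, [], [], 2⟩,
   ⟨2, fun m => m 2 1, [⟨0, .ge, 1⟩], [0], 4⟩,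
   ⟨3, fun _ => True, [], [], 3⟩,
   ⟨3, fun m => m 4 1, [⟨0, .lt, 1⟩], [0], 4⟩,
   ⟨4, fun _ => True, [], [], 4⟩]

/-- The letters over the propositions `p_x` with `p < n` and `x < 3`. -/
def miaLetters (n : ℕ) : List (List (ℕ × ℕ)) := (List.range n ×ˢ [0, 1, 2]).sublists

open Classical in
/-- The metric interval automaton into which `test N` translates. -/
noncomputable def mia (N : ℕ) : TA (ℕ × ℕ) where
  locs := 5
  init := 0
  clocks := 1
  trans := (miaLetters (5 + 2 * N)).flatMap fun L =>
    ((miaRules N).filter fun r => r.cond fun p x => (p, x) ∈ L).map fun r =>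
      ⟨r.src, L, r.guard, r.reset, r.dst⟩
  acc := [4]

theorem mem_mia_trans {N : ℕ} {e : Transition (ℕ × ℕ)} : e ∈ (mia N).trans ↔
    ∃ L ∈ miaLetters (5 + 2 * N), ∃ r ∈ miaRules N, (r.cond fun p x => (p, x) ∈ L) ∧
      e = ⟨r.src, L, r.guard, r.reset, r.dst⟩ := by
  simp only [mia, List.mem_flatMap, List.mem_map, List.mem_filter, decide_eq_true_eq]
  constructor
  · rintro ⟨L, hL, r, ⟨hr, hc⟩, rfl⟩
    exact ⟨L, hL, r, hr, hc, rfl⟩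
  · rintro ⟨L, hL, r, hr, hc, rfl⟩
    exact ⟨L, hL, r, ⟨hr, hc⟩, rfl⟩

theorem not_singular_of_two {p : ℝ≥0 → Prop} {a b : ℝ≥0} (ha : p a) (hb : p b) (hab : a ≠ b) :
    ¬ ∃ r, ∀ x, p x ↔ x = r := by
  rintro ⟨r, hr⟩
  exact hab (((hr a).1 ha).trans ((hr b).1 hb).symm)

theorem mia_isMIA (N : ℕ) : (mia N).IsMIA (indexedProps (5 + 2 * N) [0, 1, 2]) := by
  have hr : ∀ r ∈ miaRules N, r.src < 5 ∧ r.dst < 5 ∧ (∀ a ∈ r.guard, a.clock < 1) ∧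
      (∀ y ∈ r.reset, y < 1) ∧ (r.guard ≠ [] → 0 ∈ r.reset) ∧
      (r.guard = [] ∨ r.guard = [⟨0, .gt, 0⟩] ∨ r.guard = [⟨0, .ge, 1⟩] ∨
        r.guard = [⟨0, .lt, 1⟩]) := by
    intro r hr
    simp only [miaRules, List.mem_cons, List.not_mem_nil, or_false] at hr
    rcases hr with rfl | rfl | rfl | rfl | rfl | rfl | rfl | rfl | rfl | rfl | rfl | rfl | rfl <;>
      simp
  refine ⟨⟨?_, ?_, ?_, ?_, ?_, ?_, ?_⟩, rfl, ?_, ?_⟩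
  · simp [mia]
  · simp [mia]
  · intro e he
    obtain ⟨L, -, r, h, -, rfl⟩ := mem_mia_trans.1 he
    exact (hr r h).1
  · intro e he
    obtain ⟨L, -, r, h, -, rfl⟩ := mem_mia_trans.1 he
    exact (hr r h).2.1
  · intro e he
    obtain ⟨L, hL, r, h, -, rfl⟩ := mem_mia_trans.1 he
    intro p hp
    have := (List.mem_sublists.1 hL).subset hp
    rw [List.mem_product, List.mem_range] at this
    exact this
  · intro e he
    obtain ⟨L, -, r, h, -, rfl⟩ := mem_mia_trans.1 he
    exact (hr r h).2.2.1
  · intro e he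
    obtain ⟨L, -, r, h, -, rfl⟩ := mem_mia_trans.1 he
    exact (hr r h).2.2.2.1
  · intro e he
    obtain ⟨L, -, r, h, -, rfl⟩ := mem_mia_trans.1 he
    rcases (hr r h).2.2.2.2.2 with h | h | h | h <;> simp only [h]
    · exact not_singular_of_two (a := 0) (b := 1) (by simp [Guard.Holds]) (by simp [Guard.Holds])
        zero_ne_one
    · exact not_singular_of_two (a := 1) (b := 2) (by simp [Guard.Holds, Cmp.Holds])
        (by simp [Guard.Holds, Cmp.Holds]) (by norm_num)
    · exact not_singular_of_two (a := 1) (b := 2) (by simp [Guard.Holds, Cmp.Holds])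
        (by simp [Guard.Holds, Cmp.Holds]) (by norm_num)
    · exact not_singular_of_two (a := 0) (b := 1 / 2) (by simp [Guard.Holds, Cmp.Holds])
        (by simp only [Guard.Holds, List.mem_singleton, forall_eq, Cmp.Holds]
            rw [← NNReal.coe_lt_coe]; norm_num) (by simp)
  · intro e he
    obtain ⟨L, -, r, h, -, rfl⟩ := mem_mia_trans.1 he
    exact (hr r h).2.2.2.2.1

/-! ### Runs of the automaton from each of its locations -/

section Runs

variable {N : ℕ}

theorem mia_run_cons {s s' : ℕ} {v : ℕ → ℝ≥0} {τ t : ℝ≥0} {σ : Finset (ℕ × ℕ)}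
    {w : List (Finset (ℕ × ℕ) × ℝ≥0)} (hσ : ∀ q ∈ σ, q ∈ indexedProps (5 + 2 * N) [0, 1, 2]) :
    (∃ v', (mia N).Run s v τ ((σ, t) :: w) s' v') ↔ ∃ r ∈ miaRules N, r.src = s ∧
      (r.cond fun p x => (p, x) ∈ σ) ∧ r.guard.Holds (fun y => v y + (t - τ)) ∧
      ∃ v', (mia N).Run r.dst (fun y => if y ∈ r.reset then 0 else v y + (t - τ)) t w s' v' := by
  constructor
  · rintro ⟨v', h⟩
    cases h with
    | cons e _ v₁ _ _ _ _ _ _ mem reads enabled resets rest =>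
      obtain ⟨L, -, r, hr, hc, rfl⟩ := mem_mia_trans.1 mem
      obtain rfl : v₁ = _ := funext resets
      refine ⟨r, hr, rfl, ?_, enabled, v', rest⟩
      simpa only [reads] using hc
  · rintro ⟨r, hr, rfl, hc, hg, v', h⟩
    have hL : ∀ q, q ∈ σ ↔ q ∈ (List.range (5 + 2 * N) ×ˢ [0, 1, 2]).filter (· ∈ σ) := by
      intro q
      rw [List.mem_filter, decide_eq_true_eq]
      refine ⟨fun hq => ⟨?_, hq⟩, And.right⟩
      rw [← Prod.mk.eta (p := q), List.mem_product, List.mem_range]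
      exact hσ q hq
    refine ⟨v', .cons ⟨r.src, (List.range (5 + 2 * N) ×ˢ [0, 1, 2]).filter (· ∈ σ), r.guard,
      r.reset, r.dst⟩ v _ v' τ t σ w s' ?_ hL hg (fun _ => rfl) h⟩
    refine mem_mia_trans.2 ⟨_, List.mem_sublists.2 List.filter_sublist, r, hr, ?_, rfl⟩
    convert hc using 3
    exact (hL _).symm

theorem mia_run_nil {s s' : ℕ} {v : ℕ → ℝ≥0} {τ : ℝ≥0} :
    (∃ v', (mia N).Run s v τ [] s' v') ↔ s = s' :=
  ⟨fun ⟨_, h⟩ => by cases h; rfl, fun h => h ▸ ⟨v, .nil _ _ _⟩⟩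

theorem mia_run_acc (w : List (Finset (ℕ × ℕ) × ℝ≥0)) : ∀ (v : ℕ → ℝ≥0) (τ : ℝ≥0),
    (∀ e ∈ w, ∀ q ∈ e.1, q ∈ indexedProps (5 + 2 * N) [0, 1, 2]) →
    ∃ v', (mia N).Run 4 v τ w 4 v' := by
  induction w with
  | nil => exact fun v τ _ => ⟨v, .nil _ _ _⟩
  | cons e w ih =>
    intro v τ h
    refine (mia_run_cons (h e (by simp))).2 ⟨⟨4, fun _ => True, [], [], 4⟩, by simp [miaRules],
      rfl, trivial, by simp [Guard.Holds], ih _ _ fun e he => h e (by simp [he])⟩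

/-- The clock is not reset while the automaton waits, so it shows `v 0 + (t - τ)` at an event at
time `t`. The end of the test can be guessed at any marked event at which this value satisfies the
guard. -/
theorem mia_run_ge (w : List (Finset (ℕ × ℕ) × ℝ≥0)) : ∀ (v : ℕ → ℝ≥0) (τ : ℝ≥0),
    (∀ e ∈ w, ∀ q ∈ e.1, q ∈ indexedProps (5 + 2 * N) [0, 1, 2]) →
    (∀ e ∈ w, τ ≤ e.2) → w.Pairwise (fun e f => e.2 < f.2) →
    ((∃ v', (mia N).Run 2 v τ w 4 v') ↔ ∃ f ∈ w, (2, 1) ∈ f.1 ∧ 1 ≤ v 0 + (f.2 - τ)) := by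
  induction w with
  | nil => simp [mia_run_nil]
  | cons e w ih =>
    intro v τ h hτ hw
    obtain ⟨σ, t⟩ := e
    have ht : τ ≤ t := hτ (σ, t) List.mem_cons_self
    obtain ⟨hw₁, hw⟩ := List.pairwise_cons.1 hw
    rw [mia_run_cons (h (σ, t) List.mem_cons_self)]
    have h' : ∀ e ∈ w, ∀ q ∈ e.1, q ∈ indexedProps (5 + 2 * N) [0, 1, 2] :=
      fun e he => h e (by simp [he])
    have h4 := fun v => mia_run_acc (N := N) w v t h'
    simp only [Guard.Holds, Cmp.Holds]
    simp [miaRules, h4]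
    rw [ih _ _ h' (fun e he => (hw₁ e he).le) hw, or_comm, Prod.exists]
    refine or_congr Iff.rfl ?_
    refine exists_congr fun σ' => exists_congr fun t' => and_congr_right fun hm =>
      and_congr_right fun _ => ?_
    have : t ≤ t' := (hw₁ _ hm).le
    -- Subtraction is truncated here; the delays add up because `τ ≤ t ≤ t'`.
    rw [add_assoc, add_comm (t - τ), tsub_add_tsub_cancel this ht]

theorem mia_run_lt (w : List (Finset (ℕ × ℕ) × ℝ≥0)) : ∀ (v : ℕ → ℝ≥0) (τ : ℝ≥0),
    (∀ e ∈ w, ∀ q ∈ e.1, q ∈ indexedProps (5 + 2 * N) [0, 1, 2]) →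
    (∀ e ∈ w, τ ≤ e.2) → w.Pairwise (fun e f => e.2 < f.2) →
    ((∃ v', (mia N).Run 3 v τ w 4 v') ↔ ∃ f ∈ w, (4, 1) ∈ f.1 ∧ v 0 + (f.2 - τ) < 1) := by
  induction w with
  | nil => simp [mia_run_nil]
  | cons e w ih =>
    intro v τ h hτ hw
    obtain ⟨σ, t⟩ := e
    have ht : τ ≤ t := hτ (σ, t) List.mem_cons_self
    obtain ⟨hw₁, hw⟩ := List.pairwise_cons.1 hw
    rw [mia_run_cons (h (σ, t) List.mem_cons_self)]
    have h' : ∀ e ∈ w, ∀ q ∈ e.1, q ∈ indexedProps (5 + 2 * N) [0, 1, 2] :=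
      fun e he => h e (by simp [he])
    have h4 := fun v => mia_run_acc (N := N) w v t h'
    simp only [Guard.Holds, Cmp.Holds]
    simp [miaRules, h4]
    rw [ih _ _ h' (fun e he => (hw₁ e he).le) hw, or_comm, Prod.exists]
    refine or_congr Iff.rfl ?_
    refine exists_congr fun σ' => exists_congr fun t' => and_congr_right fun hm =>
      and_congr_right fun _ => ?_
    have : t ≤ t' := (hw₁ _ hm).le
    rw [add_assoc, add_comm (t - τ), tsub_add_tsub_cancel this ht]

/-- A test that starts with the first event of `w`, or a later one, succeeds. -/
def ListPasses (N : ℕ) : List (Finset (ℕ × ℕ) × ℝ≥0) → Prop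
  | [] => False
  | e :: w => (Escape N fun p x => (p, x) ∈ e.1) ∨
      (((0, 0) ∈ e.1 ∧ (1, 1) ∈ e.1) ∧ ∃ f ∈ w, (2, 1) ∈ f.1 ∧ e.2 + 1 ≤ f.2) ∨
      (((0, 0) ∈ e.1 ∧ (3, 1) ∈ e.1) ∧ ∃ f ∈ w, (4, 1) ∈ f.1 ∧ f.2 < e.2 + 1) ∨ ListPasses N w

theorem mia_run_start {w : List (Finset (ℕ × ℕ) × ℝ≥0)} {t : ℝ≥0} {v : ℕ → ℝ≥0} (hv : v 0 = 0)
    (h : ∀ e ∈ w, ∀ q ∈ e.1, q ∈ indexedProps (5 + 2 * N) [0, 1, 2])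
    (ht : ∀ e ∈ w, t < e.2) (hw : w.Pairwise (fun e f => e.2 < f.2)) :
    ((∃ v', (mia N).Run 2 v t w 4 v') ↔ ∃ f ∈ w, (2, 1) ∈ f.1 ∧ t + 1 ≤ f.2) ∧
    ((∃ v', (mia N).Run 3 v t w 4 v') ↔ ∃ f ∈ w, (4, 1) ∈ f.1 ∧ f.2 < t + 1) := by
  rw [mia_run_ge w v t h (fun e he => (ht e he).le) hw,
    mia_run_lt w v t h (fun e he => (ht e he).le) hw, hv]
  constructor
  · refine exists_congr fun f => and_congr_right fun hf => and_congr_right fun _ => ?_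
    rw [zero_add, le_tsub_iff_left (ht f hf).le]
  · refine exists_congr fun f => and_congr_right fun hf => and_congr_right fun _ => ?_
    rw [zero_add, tsub_lt_iff_left (ht f hf).le]

theorem mia_run_wait (w : List (Finset (ℕ × ℕ) × ℝ≥0)) : ∀ (v : ℕ → ℝ≥0) (τ : ℝ≥0),
    (∀ e ∈ w, ∀ q ∈ e.1, q ∈ indexedProps (5 + 2 * N) [0, 1, 2]) →
    w.Pairwise (fun e f => e.2 < f.2) →
    ((∃ v', (mia N).Run 1 v τ w 4 v') ↔ ListPasses N w) := by
  induction w with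
  | nil => simp [mia_run_nil, ListPasses]
  | cons e w ih =>
    intro v τ h hw
    obtain ⟨σ, t⟩ := e
    obtain ⟨hw₁, hw⟩ := List.pairwise_cons.1 hw
    have h' : ∀ e ∈ w, ∀ q ∈ e.1, q ∈ indexedProps (5 + 2 * N) [0, 1, 2] :=
      fun e he => h e (by simp [he])
    rw [mia_run_cons (h (σ, t) List.mem_cons_self)]
    have h4 := fun v => mia_run_acc (N := N) w v t h'
    simp only [Guard.Holds, Cmp.Holds, ListPasses]
    simp [miaRules, h4]
    rw [ih _ _ h' hw, (mia_run_start (by simp) h' hw₁ hw).1, (mia_run_start (by simp) h' hw₁ hw).2]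
    simp only [Prod.exists]
    rw [or_comm]
    simp only [or_assoc]

/-- Checking the first event against time `0` suffices, since timestamps increase. The guarded
transitions have to reset the clock, which is harmless as no test is running yet. -/
theorem mia_run_init {w : List (Finset (ℕ × ℕ) × ℝ≥0)}
    (h : ∀ e ∈ w, ∀ q ∈ e.1, q ∈ indexedProps (5 + 2 * N) [0, 1, 2])
    (hw : w.Pairwise (fun e f => e.2 < f.2)) :
    (∃ v', (mia N).Run 0 (fun _ => 0) 0 w 4 v') ↔ (∀ e ∈ w, e.2 ≠ 0) ∧ ListPasses N w := by
  cases w with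
  | nil => simp [mia_run_nil, ListPasses]
  | cons e w =>
    obtain ⟨σ, t⟩ := e
    obtain ⟨hw₁, hw⟩ := List.pairwise_cons.1 hw
    have h' : ∀ e ∈ w, ∀ q ∈ e.1, q ∈ indexedProps (5 + 2 * N) [0, 1, 2] :=
      fun e he => h e (by simp [he])
    have h0 : (∀ e ∈ (σ, t) :: w, e.2 ≠ 0) ↔ 0 < t := by
      simp only [List.forall_mem_cons]
      exact ⟨fun h => pos_iff_ne_zero.2 h.1, fun h => ⟨h.ne', fun e he => (h.trans (hw₁ e he)).ne'⟩⟩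
    rw [h0, mia_run_cons (h (σ, t) List.mem_cons_self)]
    have h4 := fun v => mia_run_acc (N := N) w v t h'
    simp only [Guard.Holds, Cmp.Holds, ListPasses]
    simp [miaRules, h4]
    rw [mia_run_wait _ _ _ h' hw, (mia_run_start (by simp) h' hw₁ hw).1,
      (mia_run_start (by simp) h' hw₁ hw).2]
    simp only [Prod.exists]
    by_cases ht : 0 < t
    · simp only [ht, true_and, and_true]
      rw [or_comm]
      simp only [or_assoc]
    · simp [ht]

end Runs

/-! ### Agreement of the automaton with the quantifier-free part -/

section Translation

variable {N : ℕ}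

/-- The recursion only looks behind the start of a test, the right-hand side looks at all events;
the time conditions themselves force the end of the test to come later. -/
theorem listPasses_iff {w : List (Finset (ℕ × ℕ) × ℝ≥0)}
    (hw : w.Pairwise (fun e f => e.2 < f.2)) : ListPasses N w ↔
      ∃ e ∈ w, (Escape N fun p x => (p, x) ∈ e.1) ∨
        (((0, 0) ∈ e.1 ∧ (1, 1) ∈ e.1) ∧ ∃ f ∈ w, e.2 + 1 ≤ f.2 ∧ (2, 1) ∈ f.1) ∨
        (((0, 0) ∈ e.1 ∧ (3, 1) ∈ e.1) ∧ ∃ f ∈ w, e.2 < f.2 ∧ f.2 < e.2 + 1 ∧ (4, 1) ∈ f.1) := by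
  induction w with
  | nil => simp [ListPasses]
  | cons e w ih =>
    obtain ⟨hw₁, hw⟩ := List.pairwise_cons.1 hw
    rw [ListPasses, ih hw]
    constructor
    · rintro (h | ⟨h, f, hf, h1, h2⟩ | ⟨h, f, hf, h1, h2⟩ | ⟨e', he', h⟩)
      · exact ⟨e, by simp, .inl h⟩
      · exact ⟨e, by simp, .inr (.inl ⟨h, f, by simp [hf], h2, h1⟩)⟩
      · exact ⟨e, by simp, .inr (.inr ⟨h, f, by simp [hf], hw₁ f hf, h2, h1⟩)⟩
      · refine ⟨e', by simp [he'], ?_⟩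
        rcases h with h | ⟨h, f, hf, h1⟩ | ⟨h, f, hf, h1⟩
        · exact .inl h
        · exact .inr (.inl ⟨h, f, by simp [hf], h1⟩)
        · exact .inr (.inr ⟨h, f, by simp [hf], h1⟩)
    · rintro ⟨e', he', h⟩
      rcases List.mem_cons.1 he' with rfl | hw'
      · rcases h with h | ⟨h, f, hf, h1, h2⟩ | ⟨h, f, hf, h0, h1, h2⟩
        · exact .inl h
        · rcases List.mem_cons.1 hf with rfl | hf
          · exact absurd h1 (lt_add_one _).not_ge
          · exact .inr (.inl ⟨h, f, hf, h2, h1⟩)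
        · rcases List.mem_cons.1 hf with rfl | hf
          · exact absurd h0 (lt_irrefl _)
          · exact .inr (.inr (.inl ⟨h, f, hf, h2, h1⟩))
      · refine .inr (.inr (.inr ⟨e', hw', ?_⟩))
        rcases h with h | ⟨h, f, hf, h1, h2⟩ | ⟨h, f, hf, h0, h1, h2⟩
        · exact .inl h
        · rcases List.mem_cons.1 hf with rfl | hf
          · exact absurd ((lt_add_one _).trans_le h1) (hw₁ e' hw').not_gt
          · exact .inr (.inl ⟨h, f, hf, h1, h2⟩)
        · rcases List.mem_cons.1 hf with rfl | hf
          · exact absurd h0 (hw₁ e' hw').not_gt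
          · exact .inr (.inr ⟨h, f, hf, h0, h1, h2⟩)

theorem listPasses_iff_passes (ρ : TimedWord (ℕ × ℕ)) : ListPasses N ρ.events ↔
    Passes N {t | ρ.OccursAt t} fun t p x => ∃ σ, (σ, t) ∈ ρ.events ∧ (p, x) ∈ σ := by
  rw [listPasses_iff (List.pairwise_map.1 ρ.increasing)]
  have hm : ∀ {σ t}, (σ, t) ∈ ρ.events → ∀ p x,
      (∃ σ, (σ, t) ∈ ρ.events ∧ (p, x) ∈ σ) ↔ (p, x) ∈ σ :=
    fun {σ t} h p x => ⟨fun ⟨σ', h', hp⟩ => ρ.letter_unique h h' ▸ hp, fun hp => ⟨σ, h, hp⟩⟩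
  constructor
  · rintro ⟨⟨σ, t⟩, he, h⟩
    refine ⟨t, ⟨σ, he⟩, ?_⟩
    simp only [hm he]
    rcases h with h | ⟨h, ⟨σ', t'⟩, hf, h1, h2⟩ | ⟨h, ⟨σ', t'⟩, hf, h0, h1, h2⟩
    · exact .inl h
    · exact .inr (.inl ⟨h, t', ⟨σ', hf⟩, h1, σ', hf, h2⟩)
    · exact .inr (.inr ⟨h, t', ⟨σ', hf⟩, h0, h1, σ', hf, h2⟩)
  · rintro ⟨t, ⟨σ, he⟩, h⟩
    refine ⟨(σ, t), he, ?_⟩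
    simp only [hm he] at h
    rcases h with h | ⟨h, t', -, h1, σ', hf, h2⟩ | ⟨h, t', -, h0, h1, σ', hf, h2⟩
    · exact .inl h
    · exact .inr (.inl ⟨h, (σ', t'), hf, h1, h2⟩)
    · exact .inr (.inr ⟨h, (σ', t'), hf, h0, h1, h2⟩)

theorem TimedWord.component_occursAt {ρ : TimedWord (ℕ × ℕ)} {x : ℕ} {t : ℝ≥0} :
    (ρ.component x).OccursAt t ↔ ρ.OccursAt t := by
  simp only [OccursAt, component, List.mem_map, Prod.mk.injEq]
  constructor
  · rintro ⟨σ, ⟨σ', t'⟩, h, -, rfl⟩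
    exact ⟨σ', h⟩
  · rintro ⟨σ, h⟩
    exact ⟨_, (σ, t), h, rfl, rfl⟩

theorem TimedWord.toAssignment_occursAt {ρ : TimedWord (ℕ × ℕ)} {V : List ℕ} (hV : V ≠ [])
    {t : ℝ≥0} : (ρ.toAssignment V).OccursAt t ↔ ρ.OccursAt t := by
  constructor
  · rintro ⟨x, ρ', h, ht⟩
    simp only [toAssignment, Option.ite_none_right_eq_some, Option.some.injEq] at h
    obtain ⟨-, rfl⟩ := h
    exact component_occursAt.1 ht
  · obtain ⟨x, hx⟩ := List.exists_mem_of_ne_nil V hV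
    exact fun ht => ⟨x, ρ.component x, by simp [toAssignment, hx], component_occursAt.2 ht⟩

theorem TimedWord.sat_atom_toAssignment {ρ : TimedWord (ℕ × ℕ)} {V : List ℕ} {t : ℝ≥0} {p x : ℕ}
    (hx : x ∈ V) : (QF.atom p x).Sat (ρ.toAssignment V) true t ↔
      ∃ σ, (σ, t) ∈ ρ.events ∧ (p, x) ∈ σ := by
  simp only [QF.Sat, toAssignment, if_pos hx, Option.some.injEq, exists_eq_left', component,
    List.mem_map, Prod.mk.injEq]
  constructor
  · rintro ⟨_, ⟨⟨σ, t'⟩, h, rfl, rfl⟩, hp⟩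
    refine ⟨σ, h, ?_⟩
    obtain ⟨⟨p', x'⟩, h', rfl⟩ := Finset.mem_image.1 hp
    obtain ⟨h1, rfl⟩ := Finset.mem_filter.1 h'
    exact h1
  · rintro ⟨σ, h, hp⟩
    exact ⟨_, ⟨(σ, t), h, rfl, rfl⟩,
      Finset.mem_image.2 ⟨(p, x), Finset.mem_filter.2 ⟨hp, rfl⟩, rfl⟩⟩

theorem Passes.congr {T : Set ℝ≥0} {m m' : ℝ≥0 → ℕ → ℕ → Prop}
    (h : ∀ t ∈ T, ∀ p, ∀ x < 2, m t p x ↔ m' t p x) : Passes N T m ↔ Passes N T m' := by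
  refine exists_congr fun t => and_congr_right fun ht => ?_
  have h0 := fun p => h t ht p 0 (by simp)
  have h1 := fun p => h t ht p 1 (by simp)
  simp only [Escape, h0, h1]
  refine or_congr_right (or_congr (and_congr_right fun _ => ?_) (and_congr_right fun _ => ?_)) <;>
    refine exists_congr fun t' => and_congr_right fun ht' => ?_ <;>
    simp only [h t' ht' _ 1 (by simp)]

theorem spec_translatesInto (N : ℕ) : TranslatesInto (5 + 2 * N) (spec N) (mia N) := by
  refine ⟨mia_isMIA N, fun ρ hρ => ?_⟩
  change _ ↔ (test N).Sat (ρ.toAssignment [0, 1, 2]) true 0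
  have hocc : ∀ t, (ρ.toAssignment [0, 1, 2]).OccursAt t ↔ ρ.OccursAt t :=
    fun t => TimedWord.toAssignment_occursAt (by simp)
  have hA : (ρ.toAssignment [0, 1, 2]).Synced {0} := by
    rintro t ht x rfl
    exact ⟨ρ.component 0, by simp [TimedWord.toAssignment],
      TimedWord.component_occursAt.2 ((hocc t).1 ht)⟩
  rw [sat_test hA]
  have hacc : (mia N).Accepts ρ ↔ ∃ v, (mia N).Run 0 (fun _ => 0) 0 ρ.events 4 v := by
    simp [TA.Accepts, mia]
  rw [hacc, mia_run_init hρ (List.pairwise_map.1 ρ.increasing), listPasses_iff_passes]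
  simp only [hocc]
  refine and_congr ?_ (Passes.congr fun t _ p x hx => ?_)
  · constructor
    · rintro h ⟨σ, hσ⟩
      exact h _ hσ rfl
    · rintro h ⟨σ, t⟩ he rfl
      exact h ⟨σ, he⟩
  · rw [TimedWord.sat_atom_toAssignment (by simp; omega)]

end Translation

/-! ### Synchronised words as functions of an index -/

/-- The timed word with the letter `ℓ i` at the time `τ i`, for `i < m`. -/
def TimedWord.ofFn (m : ℕ) (ℓ : ℕ → Finset ℕ) (τ : ℕ → ℝ≥0)
    (hτ : ∀ i j, i < j → j < m → τ i < τ j) : TimedWord ℕ where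
  events := (List.range m).map fun i => (ℓ i, τ i)
  increasing := by
    rw [List.map_map, List.pairwise_map]
    refine List.pairwise_lt_range.imp_of_mem fun {i j} _ hj hij => hτ i j hij ?_
    exact List.mem_range.1 hj

theorem List.exists_eq_map_range {α : Type} [Inhabited α] (l : List α) :
    ∃ f : ℕ → α, l = (List.range l.length).map f := by
  refine ⟨fun i => l.getD i default, List.ext_getElem (by simp) fun i h _ => ?_⟩
  simp [h]

section Index

variable {m : ℕ} {ℓ ℓ' : ℕ → Finset ℕ} {τ : ℕ → ℝ≥0} {hτ : ∀ i j, i < j → j < m → τ i < τ j}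

theorem TimedWord.mem_ofFn {σ : Finset ℕ} {t : ℝ≥0} :
    (σ, t) ∈ (ofFn m ℓ τ hτ).events ↔ ∃ i < m, ℓ i = σ ∧ τ i = t := by
  simp [ofFn]

theorem TimedWord.ofFn_occursAt {t : ℝ≥0} :
    (ofFn m ℓ τ hτ).OccursAt t ↔ ∃ i < m, τ i = t := by
  simp only [OccursAt, mem_ofFn]
  constructor
  · rintro ⟨_, i, hi, -, h⟩
    exact ⟨i, hi, h⟩
  · rintro ⟨i, hi, h⟩
    exact ⟨_, i, hi, rfl, h⟩

theorem TimedWord.exists_eq_ofFn (ρ : TimedWord ℕ) :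
    ∃ m ℓ τ hτ, ρ = ofFn m ℓ τ hτ := by
  obtain ⟨f, hf⟩ := List.exists_eq_map_range (α := Finset ℕ × ℝ≥0) ρ.events
  have h := ρ.increasing
  refine ⟨ρ.events.length, fun i => (f i).1, fun i => (f i).2, ?_, TimedWord.ext hf⟩
  intro i j hij hj
  rw [hf, List.map_map] at h
  have := List.pairwise_iff_getElem.1 h i j (by simpa using hij.trans hj) (by simpa using hj) hij
  simpa using this

/-- A strictly increasing sequence is determined by its set of values, so synchronised traces have
the same sequence of timestamps and only the letters remain free. -/
theorem TimedWord.exists_eq_ofFn_of_sync {ρ : TimedWord ℕ}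
    (h : ∀ t, ρ.OccursAt t ↔ (ofFn m ℓ τ hτ).OccursAt t) : ∃ ℓ', ρ = ofFn m ℓ' τ hτ := by
  have ht : ρ.events.map Prod.snd = (List.range m).map τ := by
    have h1 := ρ.increasing
    have h2 : ((List.range m).map τ).Pairwise (· < ·) := by
      simpa [ofFn, Function.comp_def] using (ofFn m ℓ τ hτ).increasing
    refine ((List.perm_ext_iff_of_nodup (h1.imp ne_of_lt) (h2.imp ne_of_lt)).2
      fun t => ?_).eq_of_pairwise (fun _ _ _ _ h h' => absurd h h'.not_gt) h1 h2
    have := h t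
    rw [ofFn_occursAt] at this
    simpa [OccursAt] using this
  have hl : ρ.events.length = m := by simpa using congrArg List.length ht
  obtain ⟨f, hf⟩ := List.exists_eq_map_range (α := Finset ℕ × ℝ≥0) ρ.events
  refine ⟨fun i => (f i).1, TimedWord.ext ?_⟩
  rw [hl] at hf
  rw [hf, List.map_map] at ht
  rw [hf, ofFn]
  refine List.map_congr_left fun i hi => Prod.ext rfl ?_
  exact List.map_inj_left.1 ht i hi

/-- Some test succeeds on the words with the letters `α i` and `β i` at the times `τ i`. -/
def IndexPasses (N m : ℕ) (α β : ℕ → Finset ℕ) (τ : ℕ → ℝ≥0) : Prop :=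
  ∃ i < m, (Escape N fun p x => p ∈ if x = 0 then α i else β i) ∨
    ((0 ∈ α i ∧ 1 ∈ β i) ∧ ∃ j < m, τ i + 1 ≤ τ j ∧ 2 ∈ β j) ∨
    ((0 ∈ α i ∧ 3 ∈ β i) ∧ ∃ j < m, τ i < τ j ∧ τ j < τ i + 1 ∧ 4 ∈ β j)

theorem passes_iff_indexPasses {N : ℕ} {α β : ℕ → Finset ℕ} {m' : ℝ≥0 → ℕ → ℕ → Prop}
    (hm : ∀ i < m, ∀ p, ∀ x < 2, m' (τ i) p x ↔ p ∈ if x = 0 then α i else β i) :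
    Passes N {t | ∃ i < m, τ i = t} m' ↔ IndexPasses N m α β τ := by
  have h0 := fun i hi p => hm i hi p 0 (by simp)
  have h1 := fun i hi p => hm i hi p 1 (by simp)
  simp only [if_true, if_false, one_ne_zero] at h0 h1
  simp only [Passes, IndexPasses, Set.mem_ofPred_eq, exists_exists_and_eq_and]
  refine exists_congr fun i => and_congr_right fun hi => ?_
  simp only [Escape, h0 i hi, h1 i hi, if_true, if_false, one_ne_zero]
  refine or_congr_right (or_congr (and_congr_right fun _ => ?_) (and_congr_right fun _ => ?_)) <;>
    refine exists_congr fun j => and_congr_right fun hj => ?_ <;>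
    simp only [h1 j hj]

/-- Membership in `T` depends on the letters alone. Choosing the first trace therefore means
choosing letters and times, and the second one is an arbitrary admissible word of the same length,
read at these times. -/
theorem syncModels_spec_iff {N : ℕ} {L : List (Finset ℕ) → Prop} {T : Set (TimedWord ℕ)}
    (hT : ∀ ρ, ρ ∈ T ↔ L (ρ.events.map Prod.fst)) : SyncModels T (spec N) ↔
    ∃ m α τ, (∀ i j, i < j → j < m → τ i < τ j) ∧ L ((List.range m).map α) ∧
      ∀ β, L ((List.range m).map β) → (∀ i < m, τ i ≠ 0) ∧ IndexPasses N m α β τ := by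
  have hL : ∀ m α τ hτ, TimedWord.ofFn m α τ hτ ∈ T ↔ L ((List.range m).map α) := by
    intro m α τ hτ
    rw [hT]
    simp [TimedWord.ofFn, Function.comp_def]
  have hsat : ∀ {m α β γ τ hτ} {A : Assignment}, A 0 = some (TimedWord.ofFn m α τ hτ) →
      A 1 = some (TimedWord.ofFn m β τ hτ) → A 2 = some (TimedWord.ofFn m γ τ hτ) →
      (∀ x, 2 < x → A x = none) →
      ((test N).Sat A true 0 ↔ (∀ i < m, τ i ≠ 0) ∧ IndexPasses N m α β τ) := by
    intro m α β γ τ hτ A h0 h1 h2 h3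
    have hocc : ∀ t, A.OccursAt t ↔ ∃ i < m, τ i = t := by
      intro t
      constructor
      · rintro ⟨x, ρ, hx, ht⟩
        rcases Nat.lt_or_ge 2 x with h | h
        · simp [h3 x h] at hx
        · interval_cases x
          · obtain rfl := Option.some_injective _ (h0.symm.trans hx)
            exact TimedWord.ofFn_occursAt.1 ht
          · obtain rfl := Option.some_injective _ (h1.symm.trans hx)
            exact TimedWord.ofFn_occursAt.1 ht
          · obtain rfl := Option.some_injective _ (h2.symm.trans hx)
            exact TimedWord.ofFn_occursAt.1 ht
      · exact fun h => ⟨0, _, h0, TimedWord.ofFn_occursAt.2 h⟩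
    have hA : A.Synced {0} := by
      rintro t ht x rfl
      exact ⟨_, h0, TimedWord.ofFn_occursAt.2 ((hocc t).1 ht)⟩
    rw [sat_test hA]
    simp only [hocc]
    refine and_congr (by simp) (passes_iff_indexPasses fun i hi p x hx => ?_)
    have hinj : ∀ j < m, τ j = τ i → j = i := by
      intro j hj hji
      rcases lt_trichotomy j i with h | h | h
      · exact absurd hji (hτ j i h hi).ne
      · exact h
      · exact absurd hji (hτ i j h hj).ne'
    have key : ∀ {δ : ℕ → Finset ℕ}, A x = some (TimedWord.ofFn m δ τ hτ) →
        ((QF.atom p x).Sat A true (τ i) ↔ p ∈ δ i) := by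
      intro δ hδ
      simp only [QF.Sat, hδ, Option.some.injEq, exists_eq_left', TimedWord.mem_ofFn]
      constructor
      · rintro ⟨_, ⟨j, hj, rfl, hji⟩, hp⟩
        rwa [hinj j hj hji] at hp
      · exact fun hp => ⟨_, ⟨i, hi, rfl, rfl⟩, hp⟩
    interval_cases x
    · exact key h0
    · exact key h1
  constructor
  · rintro ⟨ρ, hρ, -, h⟩
    obtain ⟨m, α, τ, hτ, rfl⟩ := ρ.exists_eq_ofFn
    refine ⟨m, α, τ, hτ, (hL ..).1 hρ, fun β hβ => ?_⟩
    -- The test does not mention the trace `2`, so the first trace also serves as the third.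
    have hb := h (TimedWord.ofFn m β τ hτ) ((hL ..).2 hβ) ?_ (TimedWord.ofFn m α τ hτ) hρ ?_
    · exact (hsat (γ := α) (hτ := hτ) (by simp [Function.update]) (by simp [Function.update])
        (by simp [Function.update]) (fun x hx => by
          simp [Function.update, show x ≠ 0 by omega, show x ≠ 1 by omega, show x ≠ 2 by omega])).1 hb
    · intro x ρ' hx t
      simp only [Function.update_apply, Option.ite_none_right_eq_some, Option.some.injEq] at hx
      obtain ⟨-, rfl⟩ := hx
      rw [TimedWord.ofFn_occursAt, TimedWord.ofFn_occursAt]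
    · intro x ρ' hx t
      simp only [Function.update_apply] at hx
      split_ifs at hx
      all_goals
        obtain rfl := Option.some_injective _ hx
        simp only [TimedWord.ofFn_occursAt]
  · rintro ⟨m, α, τ, hτ, hα, h⟩
    refine ⟨TimedWord.ofFn m α τ hτ, (hL ..).2 hα, fun _ _ h => by simp at h, ?_⟩
    intro ρb hb hsb ρc hc hsc
    obtain ⟨β, rfl⟩ := TimedWord.exists_eq_ofFn_of_sync
      (hsb 0 (TimedWord.ofFn m α τ hτ) (by simp))
    obtain ⟨γ, rfl⟩ := TimedWord.exists_eq_ofFn_of_sync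
      (hsc 0 (TimedWord.ofFn m α τ hτ) (by simp [Function.update]))
    exact (hsat (γ := γ) (hτ := hτ) (by simp [Function.update]) (by simp [Function.update])
        (by simp [Function.update]) (fun x hx => by
          simp [Function.update, show x ≠ 0 by omega, show x ≠ 1 by omega, show x ≠ 2 by omega])).2
        (h β ((hL ..).1 hb))

end Index

/-! ### The tests force a constant delay -/

theorem Path.of_states {α β : Type} {E : α → β → α → Prop} (st : ℕ → α) (ℓ : ℕ → β) (m : ℕ)
    (h : ∀ k < m, E (st k) (ℓ k) (st (k + 1))) :
    Path E (st 0) ((List.range m).map ℓ) (st m) := by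
  induction m with
  | zero => exact .nil _
  | succ m ih =>
    rw [List.range_succ, List.map_append]
    exact (ih fun k hk => h k (by omega)).append (.single (h m (by omega)))

/-! ### The words of marks and their encoding by propositions -/

section Marks

variable {K G Q : Type}

/-- The marks of the pattern `p` at the positions `i`, `i + 1`, `j`, `j + 1`. -/
def Pattern.place (p : Pattern K G) (i j k : ℕ) : Mark K G :=
  if k = i then p.m₁ else if k = i + 1 then p.m₂ else if k = j then p.m₃
  else if k = j + 1 then p.m₄ else .none

theorem Pattern.path_place (p : Pattern K G) {i j m : ℕ} (hij : i + 2 ≤ j) (hj : j + 1 < m)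
    (hp : p = .gap → j = i + 2) :
    Path (MarkEdge (Q := Q)) .start ((List.range m).map (p.place i j)) .fin := by
  have h := Path.of_states (E := MarkEdge (Q := Q)) (fun k => if k = 0 then .start
    else if k ≤ i then .idle else if k = i + 1 then .mark₁ p else if k ≤ j then .mark₂ p
    else if k = j + 1 then .mark₃ p else .fin) (p.place i j) m ?_
  · simpa [show m ≠ 0 by omega, show ¬ m ≤ i by omega, show m ≠ i + 1 by omega,
      show ¬ m ≤ j by omega, show m ≠ j + 1 by omega] using h
  · intro k hk
    simp only [Pattern.place, Nat.add_eq_zero_iff, one_ne_zero, and_false, if_false]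
    rcases lt_trichotomy k i with h | rfl | h
    · simp only [show k ≠ i by omega, show k ≠ i + 1 by omega, show k ≠ j by omega,
        show k ≠ j + 1 by omega, show k ≤ i by omega, show k + 1 ≤ i by omega, if_true, if_false]
      split_ifs
      · exact .start_idle
      · exact .idle
    · simp only [show ¬ k + 1 ≤ k by omega, le_refl, if_true, if_false]
      split_ifs
      · exact .start p
      · exact .first p
    · simp only [show k ≠ i by omega, show k ≠ 0 by omega, show ¬ k ≤ i by omega,
        show ¬ k + 1 ≤ i by omega, show k + 1 ≠ i + 1 by omega, if_false]
      rcases Nat.lt_or_ge (i + 1) k with h' | h'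
      · simp only [show k ≠ i + 1 by omega, if_false]
        rcases lt_trichotomy k j with h'' | rfl | h''
        · simp only [show k ≠ j by omega, show k ≠ j + 1 by omega, show k ≤ j by omega,
            show k + 1 ≤ j by omega, if_true, if_false]
          exact .wait fun hg => by have := hp hg; omega
        · simp only [le_refl, show ¬ k + 1 ≤ k by omega, if_true, if_false]
          exact .third p
        · simp only [show k ≠ j by omega, show ¬ k ≤ j by omega, show ¬ k + 1 ≤ j by omega,
            show k + 1 ≠ j + 1 by omega, if_false]
          split_ifs
          · exact .fourth p
          · exact .fin
      · simp only [show k = i + 1 by omega, show i + 1 + 1 ≤ j by omega, if_true]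
        exact .second p

/-- The marks `ge₁` and `ge₂` on the first and the last position. -/
def wholeMarks (K G : Type) (m k : ℕ) : Mark K G :=
  if k = 0 then .ge₁ else if k + 1 = m then .ge₂ else .none

theorem path_wholeMarks {m : ℕ} (hm : 2 ≤ m) :
    Path (MarkEdge (Q := Q)) .start ((List.range m).map (wholeMarks K G m)) .acc := by
  have h := Path.of_states (E := MarkEdge (K := K) (G := G) (Q := Q)) (fun k => if k = 0 then .start
    else if k = m then .acc else .whole) (wholeMarks K G m) m ?_
  · simpa [show m ≠ 0 by omega] using h
  · intro k hk
    simp only [wholeMarks, Nat.add_eq_zero_iff, one_ne_zero, and_false, if_false,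
      show k ≠ m by omega]
    rcases Nat.eq_zero_or_pos k with rfl | h
    · simp only [show 0 + 1 ≠ m by omega, if_true, if_false]
      exact .start_whole
    · simp only [show k ≠ 0 by omega, if_false]
      split_ifs
      · exact .last
      · exact .whole

theorem marks_fin {b : List (Mark K G)} (h : Path (MarkEdge (Q := Q)) .fin b .fin) :
    ∃ l, b = List.replicate l .none := by
  induction b with
  | nil => exact ⟨0, rfl⟩
  | cons a b ih =>
    obtain ⟨t, he, h⟩ := Path.cons_iff.1 h
    cases he
    obtain ⟨l, rfl⟩ := ih h
    exact ⟨l + 1, rfl⟩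

theorem marks_mark₂ {p : Pattern K G} {b : List (Mark K G)}
    (h : Path (MarkEdge (Q := Q)) (.mark₂ p) b .fin) :
    ∃ d l, b = List.replicate d .none ++ p.m₃ :: p.m₄ :: List.replicate l .none ∧
      (p = .gap → d = 0) := by
  induction b with
  | nil => simp [Path.nil_iff] at h
  | cons a b ih =>
    obtain ⟨t, he, h⟩ := Path.cons_iff.1 h
    cases he with
    | wait hp =>
      obtain ⟨d, l, rfl, -⟩ := ih h
      exact ⟨d + 1, l, rfl, fun h => absurd h hp⟩
    | third =>
      cases b with
      | nil => simp [Path.nil_iff] at h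
      | cons a b =>
        obtain ⟨t, he, h⟩ := Path.cons_iff.1 h
        cases he
        obtain ⟨l, rfl⟩ := marks_fin h
        exact ⟨0, l, rfl, fun _ => rfl⟩

theorem marks_mark₁ {p : Pattern K G} {b : List (Mark K G)}
    (h : Path (MarkEdge (Q := Q)) (.mark₁ p) b .fin) :
    ∃ d l, b = p.m₂ :: (List.replicate d .none ++ p.m₃ :: p.m₄ :: List.replicate l .none) ∧
      (p = .gap → d = 0) := by
  cases b with
  | nil => simp [Path.nil_iff] at h
  | cons a b =>
    obtain ⟨t, he, h⟩ := Path.cons_iff.1 h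
    cases he
    obtain ⟨d, l, rfl, hd⟩ := marks_mark₂ h
    exact ⟨d, l, rfl, hd⟩

theorem marks_idle {b : List (Mark K G)} (h : Path (MarkEdge (Q := Q)) .idle b .fin) :
    ∃ (p : Pattern K G) (c d l : ℕ), b = List.replicate c .none ++ p.m₁ :: p.m₂ ::
      (List.replicate d .none ++ p.m₃ :: p.m₄ :: List.replicate l .none) ∧
      (p = .gap → d = 0) := by
  induction b with
  | nil => simp [Path.nil_iff] at h
  | cons a b ih =>
    obtain ⟨t, he, h⟩ := Path.cons_iff.1 h
    cases he with
    | idle =>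
      obtain ⟨p, c, d, l, rfl, hd⟩ := ih h
      exact ⟨p, c + 1, d, l, rfl, hd⟩
    | first p =>
      obtain ⟨d, l, rfl, hd⟩ := marks_mark₁ h
      exact ⟨p, 0, d, l, rfl, hd⟩

theorem marks_whole {b : List (Mark K G)} {t : Loc K G Q} (ht : t = .acc ∨ t = .fin)
    (h : Path (MarkEdge (Q := Q)) .whole b t) :
    t = .acc ∧ ∃ c, b = List.replicate c .none ++ [.ge₂] := by
  induction b with
  | nil =>
    obtain rfl := Path.nil_iff.1 h
    simp at ht
  | cons a b ih =>
    obtain ⟨t', he, h⟩ := Path.cons_iff.1 h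
    cases he with
    | whole =>
      obtain ⟨h', c, rfl⟩ := ih h
      exact ⟨h', c + 1, rfl⟩
    | last =>
      cases h with
      | nil => exact ⟨rfl, 0, rfl⟩
      | cons he h => cases he

theorem marks_not_acc {b : List (Mark K G)} {s : Loc K G Q}
    (hs : s = .idle ∨ (∃ p, s = .mark₁ p) ∨ (∃ p, s = .mark₂ p) ∨ (∃ p, s = .mark₃ p) ∨ s = .fin) :
    ¬ Path (MarkEdge (Q := Q)) s b .acc := by
  induction b generalizing s with
  | nil => rw [Path.nil_iff]; rintro rfl; simp at hs
  | cons a b ih =>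
    intro h
    obtain ⟨t, he, h⟩ := Path.cons_iff.1 h
    refine ih ?_ h
    cases he <;> simp at hs ⊢

/-- Converse to `Pattern.path_place` and `path_wholeMarks`: there are no other words of marks. This
is what makes it possible to check every second trace against a given choice of timestamps. -/
theorem marks_start {b : List (Mark K G)} (h : Path (MarkEdge (Q := Q)) .start b .acc ∨
    Path (MarkEdge (Q := Q)) .start b .fin) :
    (∃ c, b = .ge₁ :: (List.replicate c .none ++ [.ge₂])) ∨
    ∃ (p : Pattern K G) (c d l : ℕ), b = List.replicate c .none ++ p.m₁ :: p.m₂ ::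
      (List.replicate d .none ++ p.m₃ :: p.m₄ :: List.replicate l .none) ∧
      (p = .gap → d = 0) := by
  obtain ⟨t, ht, h⟩ : ∃ t, (t = .acc ∨ t = .fin) ∧ Path (MarkEdge (Q := Q)) .start b t :=
    h.elim (fun h => ⟨_, .inl rfl, h⟩) fun h => ⟨_, .inr rfl, h⟩
  cases h with
  | nil => simp at ht
  | cons he h =>
    cases he with
    | start_idle =>
      rcases ht with rfl | rfl
      · exact absurd h (marks_not_acc (by simp))
      · obtain ⟨p, c, d, l, rfl, hd⟩ := marks_idle h
        exact .inr ⟨p, c + 1, d, l, rfl, hd⟩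
    | start p =>
      rcases ht with rfl | rfl
      · exact absurd h (marks_not_acc (by simp))
      · obtain ⟨d, l, rfl, hd⟩ := marks_mark₁ h
        exact .inr ⟨p, 0, d, l, rfl, hd⟩
    | start_whole =>
      obtain ⟨-, c, rfl⟩ := marks_whole ht h
      exact .inl ⟨c, rfl⟩

/-- Some test with the marks `μ` succeeds on the word with the letters `a i` at the times
`τ i`. -/
def MarkPasses (m : ℕ) (a : ℕ → Sym K G × Sym K G) (μ : ℕ → Mark K G) (τ : ℕ → ℝ≥0) : Prop :=
  ∃ i < m, ((∃ s, μ i = .both s ∧ (a i).2 ≠ s) ∨ ∃ s, μ i = .claim s ∧ (a i).1 = s) ∨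
    ((μ i = .ge₁ ∨ ∃ s, μ i = .both s) ∧ ∃ j < m, τ i + 1 ≤ τ j ∧ μ j = .ge₂) ∨
    ((μ i = .lt₁ ∨ ∃ s, μ i = .both s) ∧ ∃ j < m, τ i < τ j ∧ τ j < τ i + 1 ∧
      (μ j = .lt₂ ∨ ∃ s, μ j = .claim s))

section Props

variable [Finite K] [Finite G]

theorem zero_notMem_props (μ : Mark K G) : 0 ∉ μ.props := by
  cases μ <;> simp [Mark.props, Sym.written, Sym.read] <;> omega

/-- Parity separates the propositions for written symbols from those for read symbols, and
`Sym.index` is injective, so symbols can be recovered. The alternative `m 0 1` drops out because no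
mark contains the proposition `0`. -/
theorem escape_rowProps (a : Sym K G × Sym K G) (μ : Mark K G) :
    (Escape (Nat.card (Sym K G)) fun p x =>
      p ∈ if x = 0 then (rowProps a).toFinset else μ.props.toFinset) ↔
      (∃ s, μ = .both s ∧ a.2 ≠ s) ∨ ∃ s, μ = .claim s ∧ a.1 = s := by
  have hw : ∀ i, 5 + 2 * i ∈ rowProps a ↔ i = a.2.index := by
    intro i
    simp only [rowProps, Sym.read, Sym.written, List.mem_cons, List.not_mem_nil, or_false]
    omega
  have hr : ∀ i, 6 + 2 * i ∈ rowProps a ↔ i = a.1.index := by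
    intro i
    simp only [rowProps, Sym.read, Sym.written, List.mem_cons, List.not_mem_nil, or_false]
    omega
  have h5 : ∀ i, 5 + 2 * i ∈ μ.props ↔ ∃ s, μ = .both s ∧ i = s.index := by
    intro i
    cases μ <;> simp [Mark.props, Sym.read, Sym.written] <;> omega
  have h6 : ∀ i, 6 + 2 * i ∈ μ.props ↔ ∃ s, μ = .claim s ∧ i = s.index := by
    intro i
    cases μ <;> simp [Mark.props, Sym.read, Sym.written] <;> omega
  have h0 : 0 ∈ rowProps a := by simp [rowProps]
  simp only [Escape, if_true, if_false, one_ne_zero, List.mem_toFinset, hw, hr, h5, h6,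
    zero_notMem_props, h0, true_and, false_or]
  constructor
  · rintro ⟨_, -, ⟨⟨s, rfl, rfl⟩, h⟩ | ⟨⟨s, rfl, rfl⟩, h⟩⟩
    · exact .inl ⟨s, rfl, fun h' => h (by rw [h'])⟩
    · exact .inr ⟨s, rfl, (Sym.index_injective h).symm⟩
  · rintro (⟨s, rfl, h⟩ | ⟨s, rfl, h⟩)
    · exact ⟨s.index, s.index_lt, .inl ⟨⟨s, rfl, rfl⟩, fun h' => h (Sym.index_injective h').symm⟩⟩
    · exact ⟨s.index, s.index_lt, .inr ⟨⟨s, rfl, rfl⟩, by rw [h]⟩⟩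

theorem indexPasses_iff_markPasses {m : ℕ} {α β : ℕ → Finset ℕ} {τ : ℕ → ℝ≥0}
    {a : ℕ → Sym K G × Sym K G} {μ : ℕ → Mark K G}
    (hα : ∀ i < m, α i = (rowProps (a i)).toFinset) (hβ : ∀ i < m, β i = (μ i).props.toFinset) :
    IndexPasses (Nat.card (Sym K G)) m α β τ ↔ MarkPasses m a μ τ := by
  have h1 : ∀ ν : Mark K G, 1 ∈ ν.props ↔ ν = .ge₁ ∨ ∃ s, ν = .both s := by
    intro ν
    cases ν <;> simp [Mark.props, Sym.written, Sym.read]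
    omega
  have h2 : ∀ ν : Mark K G, 2 ∈ ν.props ↔ ν = .ge₂ := by
    intro ν
    cases ν <;> simp [Mark.props, Sym.written, Sym.read] <;> omega
  have h3 : ∀ ν : Mark K G, 3 ∈ ν.props ↔ ν = .lt₁ ∨ ∃ s, ν = .both s := by
    intro ν
    cases ν <;> simp [Mark.props, Sym.written, Sym.read]
    omega
  have h4 : ∀ ν : Mark K G, 4 ∈ ν.props ↔ ν = .lt₂ ∨ ∃ s, ν = .claim s := by
    intro ν
    cases ν <;> simp [Mark.props, Sym.written, Sym.read]
    omega
  refine exists_congr fun i => and_congr_right fun hi => ?_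
  have h0 : 0 ∈ rowProps (a i) := by simp [rowProps]
  rw [hα i hi, hβ i hi, escape_rowProps]
  simp only [List.mem_toFinset, h0, h1, h3, true_and]
  refine or_congr_right (or_congr (and_congr_right fun _ => ?_) (and_congr_right fun _ => ?_)) <;>
    refine exists_congr fun j => and_congr_right fun hj => ?_ <;>
    simp only [hβ j hj, List.mem_toFinset, h2, h4]

end Props

end Marks

/-! ### The timing conditions expressed by marks -/

section Patterns

variable {K G Q : Type}

/-- The test with the pattern `p` at the positions `i` and `j` succeeds. -/
def Pattern.Succeeds (p : Pattern K G) (a : ℕ → Sym K G × Sym K G) (τ : ℕ → ℝ≥0) (i j : ℕ) :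
    Prop :=
  match p with
  | gap => τ j < τ i + 1
  | fwd => τ j < τ i + 1 ∨ τ (i + 1) + 1 ≤ τ (j + 1)
  | bwd => τ i + 1 ≤ τ j ∨ τ (j + 1) < τ (i + 1) + 1
  | copy s => (a i).2 ≠ s ∨ (a (j + 1)).1 = s ∨ τ i + 1 ≤ τ j ∨ τ (j + 1) < τ i + 1

/-- Each alternative on the right comes from one matching pair of a start and an end mark or, for
`copy s`, from one of the two marks that carry a symbol. All other combinations of marked positions
are excluded by comparing constructors. -/
theorem Pattern.markPasses_place {p : Pattern K G} {i j m : ℕ} {a : ℕ → Sym K G × Sym K G}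
    {τ : ℕ → ℝ≥0} (hτ : ∀ i j, i < j → j < m → τ i < τ j) (hij : i + 2 ≤ j) (hj : j + 1 < m) :
    MarkPasses m a (p.place i j) τ ↔ p.Succeeds a τ i j := by
  have e₁ : p.place i j i = p.m₁ := by simp [place]
  have e₂ : p.place i j (i + 1) = p.m₂ := by simp [place]
  have e₃ : p.place i j j = p.m₃ := by
    simp [place, show j ≠ i by omega, show j ≠ i + 1 by omega]
  have e₄ : p.place i j (j + 1) = p.m₄ := by
    simp [place, show j + 1 ≠ i by omega, show j ≠ i by omega]
  have key : ∀ {k ν}, p.place i j k = ν → (k = i ∧ p.m₁ = ν) ∨ (k = i + 1 ∧ p.m₂ = ν) ∨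
      (k = j ∧ p.m₃ = ν) ∨ (k = j + 1 ∧ p.m₄ = ν) ∨ .none = ν := by
    intro k ν h
    unfold place at h
    split_ifs at h <;> simp [*]
  constructor
  · rintro ⟨k, hk, (⟨s, hs, h⟩ | ⟨s, hs, h⟩) | ⟨hs, l, hl, h, hs'⟩ | ⟨hs, l, hl, -, h, hs'⟩⟩
    · rcases key hs with ⟨rfl, e⟩ | ⟨rfl, e⟩ | ⟨rfl, e⟩ | ⟨rfl, e⟩ | e <;> cases p <;> cases e
      exact .inl h
    · rcases key hs with ⟨rfl, e⟩ | ⟨rfl, e⟩ | ⟨rfl, e⟩ | ⟨rfl, e⟩ | e <;> cases p <;> cases e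
      exact .inr (.inl h)
    · rcases hs with hs | ⟨s, hs⟩ <;>
        rcases key hs with ⟨rfl, e⟩ | ⟨rfl, e⟩ | ⟨rfl, e⟩ | ⟨rfl, e⟩ | e <;> cases p <;> cases e <;>
        rcases key hs' with ⟨rfl, e⟩ | ⟨rfl, e⟩ | ⟨rfl, e⟩ | ⟨rfl, e⟩ | e <;> cases e <;>
        simp [Succeeds, h]
    · rcases hs with hs | ⟨s, hs⟩ <;> rcases hs' with hs' | ⟨s', hs'⟩ <;>
        rcases key hs with ⟨rfl, e⟩ | ⟨rfl, e⟩ | ⟨rfl, e⟩ | ⟨rfl, e⟩ | e <;> cases p <;> cases e <;>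
        rcases key hs' with ⟨rfl, e⟩ | ⟨rfl, e⟩ | ⟨rfl, e⟩ | ⟨rfl, e⟩ | e <;> cases e <;>
        simp [Succeeds, h]
  · intro h
    have hlt : τ i < τ j := hτ _ _ (by omega) (by omega)
    have hlt' : τ (i + 1) < τ (j + 1) := hτ _ _ (by omega) (by omega)
    have hlt'' : τ i < τ (j + 1) := hτ _ _ (by omega) (by omega)
    cases p with
    | gap => exact ⟨i, by omega, .inr (.inr ⟨.inl e₁, j, by omega, hlt, h, .inl e₃⟩)⟩
    | fwd =>
      rcases h with h | h
      · exact ⟨i, by omega, .inr (.inr ⟨.inl e₁, j, by omega, hlt, h, .inl e₃⟩)⟩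
      · exact ⟨i + 1, by omega, .inr (.inl ⟨.inl e₂, j + 1, hj, h, e₄⟩)⟩
    | bwd =>
      rcases h with h | h
      · exact ⟨i, by omega, .inr (.inl ⟨.inl e₁, j, by omega, h, e₃⟩)⟩
      · exact ⟨i + 1, by omega, .inr (.inr ⟨.inl e₂, j + 1, hj, hlt', h, .inl e₄⟩)⟩
    | copy s =>
      rcases h with h | h | h | h
      · exact ⟨i, by omega, .inl (.inl ⟨s, e₁, h⟩)⟩
      · exact ⟨j + 1, hj, .inl (.inr ⟨s, e₄, h⟩)⟩
      · exact ⟨i, by omega, .inr (.inl ⟨.inr ⟨s, e₁⟩, j, by omega, h, e₃⟩)⟩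
      · exact ⟨i, by omega, .inr (.inr ⟨.inr ⟨s, e₁⟩, j + 1, hj, hlt'', h, .inr ⟨s, e₄⟩⟩)⟩

theorem markPasses_wholeMarks {m : ℕ} {a : ℕ → Sym K G × Sym K G} {τ : ℕ → ℝ≥0} (hm : 2 ≤ m) :
    MarkPasses m a (wholeMarks K G m) τ ↔ τ 0 + 1 ≤ τ (m - 1) := by
  have key : ∀ {k ν}, wholeMarks K G m k = ν → (k = 0 ∧ .ge₁ = ν) ∨ (k = m - 1 ∧ .ge₂ = ν) ∨
      .none = ν := by
    intro k ν h
    unfold wholeMarks at h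
    split_ifs at h with h1 h2
    · exact .inl ⟨h1, h⟩
    · exact .inr (.inl ⟨by omega, h⟩)
    · exact .inr (.inr h)
  constructor
  · rintro ⟨k, hk, (⟨s, hs, h⟩ | ⟨s, hs, h⟩) | ⟨hs, l, hl, h, hs'⟩ | ⟨hs, l, hl, -, h, hs'⟩⟩
    · rcases key hs with ⟨-, e⟩ | ⟨-, e⟩ | e <;> cases e
    · rcases key hs with ⟨-, e⟩ | ⟨-, e⟩ | e <;> cases e
    · rcases hs with hs | ⟨s, hs⟩ <;> rcases key hs with ⟨rfl, e⟩ | ⟨rfl, e⟩ | e <;> cases e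
      rcases key hs' with ⟨rfl, e⟩ | ⟨rfl, e⟩ | e <;> cases e
      exact h
    · rcases hs with hs | ⟨s, hs⟩ <;> rcases key hs with ⟨rfl, e⟩ | ⟨rfl, e⟩ | e <;> cases e
  · intro h
    refine ⟨0, by omega, .inr (.inl ⟨.inl (by simp [wholeMarks]), m - 1, by omega, h, ?_⟩)⟩
    simp [wholeMarks, show m - 1 ≠ 0 by omega, show m - 1 + 1 = m by omega]

theorem marks_eq_map_place (p : Pattern K G) (c d l : ℕ) :
    List.replicate c .none ++ p.m₁ :: p.m₂ ::
      (List.replicate d .none ++ p.m₃ :: p.m₄ :: List.replicate l .none) =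
    (List.range (c + (d + (l + 2) + 2))).map (p.place c (c + d + 2)) := by
  refine List.ext_getElem (by simp) fun k h₁ h₂ => ?_
  simp only [List.getElem_append, List.getElem_cons, List.getElem_replicate, List.length_replicate,
    List.getElem_map, List.getElem_range, Pattern.place]
  split_ifs <;> first | rfl | omega

theorem wholeMarks_eq_map (c : ℕ) : .ge₁ :: (List.replicate c .none ++ [.ge₂]) =
    (List.range (c + 2)).map (wholeMarks K G (c + 2)) := by
  refine List.ext_getElem (by simp) fun k h₁ h₂ => ?_
  simp only [List.length_map, List.length_range] at h₂
  simp only [List.getElem_append, List.getElem_cons, List.getElem_replicate, List.length_replicate,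
    List.getElem_map, List.getElem_range, wholeMarks]
  split_ifs <;> first | rfl | omega

end Patterns

/-- Passage from the list form of the delay condition, used in the simulation, to the indexed form,
in which timestamps can be compared. -/
theorem map_fst_drop_prefix_iff {α : Type} {m N : ℕ} {a : ℕ → α × α} :
    (((List.range m).map a).drop N).map Prod.fst <+: ((List.range m).map a).map Prod.snd ↔
      ∀ i, i + N < m → (a i).2 = (a (i + N)).1 := by
  rw [List.prefix_iff_getElem]
  simp only [List.length_map, List.length_drop, List.length_range, List.getElem_map,
    List.getElem_drop, List.getElem_range]
  constructor
  · rintro ⟨-, h⟩ i hi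
    rw [← h i (by omega), Nat.add_comm]
  · refine fun h => ⟨by omega, fun i hi => ?_⟩
    rw [Nat.add_comm, h i (by omega)]

/-! ### Passing all tests amounts to a constant delay -/

section Equivalence

variable {K G Q : Type} {M : StackMachine K G Q} {x : ℕ}

/-- Let `N` be the first position at distance at least 1 from position `0`. From `i` to `i + 1`,
`fwd` carries over that `i + N` is far enough, and `bwd` that `i + N - 1` is not. So `i + N` is the
first position at distance at least 1 from `i`, and in the test `copy` for the symbol written at `i`
the only alternative left is that position `i + N` reads it. -/
theorem delay_of_succeeds {m : ℕ} {a : ℕ → Sym K G × Sym K G} {τ : ℕ → ℝ≥0}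
    (hτ : ∀ i j, i < j → j < m → τ i < τ j) (hm : 4 ≤ m)
    (hp : ∀ p i j, i + 2 ≤ j → j + 1 < m → (p = .gap → j = i + 2) →
      Pattern.Succeeds (K := K) (G := G) p a τ i j)
    (hw : τ 0 + 1 ≤ τ (m - 1)) :
    ∃ N, 3 ≤ N ∧ N < m ∧ ∀ i, i + N < m → (a i).2 = (a (i + N)).1 := by
  classical
  have hex : ∃ N, τ 0 + 1 ≤ τ N := ⟨m - 1, hw⟩
  -- This gives `N ≥ 3`, so the patterns used below with `j = i + N - 1` have their marks on four
  -- distinct positions.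
  have h2 : τ 2 < τ 0 + 1 := hp .gap 0 2 (by omega) (by omega) fun _ => rfl
  have hN : τ 0 + 1 ≤ τ (Nat.find hex) := Nat.find_spec hex
  have hmin : ∀ k < Nat.find hex, ¬ τ 0 + 1 ≤ τ k := fun k hk => Nat.find_min hex hk
  have hNm : Nat.find hex ≤ m - 1 := Nat.find_min' hex hw
  generalize Nat.find hex = N at hN hmin hNm
  have h3 : 3 ≤ N := by
    by_contra h
    have : τ N ≤ τ 2 := by
      rcases (show N = 2 ∨ N < 2 by omega) with rfl | h
      · exact le_rfl
      · exact (hτ _ _ h (by omega)).le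
    exact absurd (hN.trans this) h2.not_ge
  have hdelay : ∀ i, i + N < m → τ i + 1 ≤ τ (i + N) ∧ ¬ τ i + 1 ≤ τ (i + N - 1) := by
    intro i
    induction i with
    | zero => exact fun _ => by simpa using ⟨hN, by simpa using hmin (N - 1) (by omega)⟩
    | succ i ih =>
      intro hi
      obtain ⟨h₁, h₂⟩ := ih (by omega)
      refine ⟨?_, fun h => ?_⟩
      · rcases hp .fwd i (i + N) (by omega) (by omega) (by simp) with h | h
        · exact absurd h₁ h.not_ge
        · rwa [show i + 1 + N = i + N + 1 by omega]
      · rcases hp .bwd i (i + N - 1) (by omega) (by omega) (by simp) with h' | h'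
        · exact h₂ h'
        · rw [show i + N - 1 + 1 = i + 1 + N - 1 by omega] at h'
          exact absurd h h'.not_ge
  refine ⟨N, h3, by omega, fun i hi => ?_⟩
  obtain ⟨h₁, h₂⟩ := hdelay i hi
  have h := hp (.copy (a i).2) i (i + N - 1) (by omega) (by omega) (by simp)
  rcases h with h | h | h | h
  · exact absurd rfl h
  · rw [← h, show i + N - 1 + 1 = i + N by omega]
  · exact absurd h h₂
  · rw [show i + N - 1 + 1 = i + N by omega] at h
    exact absurd h₁ h.not_ge

/-- With the times `(k + 1) / N`, a distance of at least 1 is an index difference of at least `N`,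
and the patterns reduce to linear arithmetic. The exception is `copy s` at `j + 1 = i + N`, which is
the delay condition itself. The summand 1 keeps the first event away from time `0`. -/
theorem succeeds_of_delay {m N : ℕ} {a : ℕ → Sym K G × Sym K G} (hN : 3 ≤ N)
    (ha : ∀ i, i + N < m → (a i).2 = (a (i + N)).1) {p : Pattern K G} {i j : ℕ} (hj : j + 1 < m)
    (hp : p = .gap → j = i + 2) :
    p.Succeeds a (fun k => (k + 1) / N) i j := by
  have hT : ∀ i j : ℕ, ((i : ℝ≥0) + 1) / N + 1 ≤ (j + 1) / N ↔ i + N ≤ j := by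
    have hN0 : (0 : ℝ≥0) < N := by exact_mod_cast (by omega : 0 < N)
    intro i j
    rw [div_add_one hN0.ne', div_le_div_iff_of_pos_right hN0]
    exact_mod_cast (by omega : i + 1 + N ≤ j + 1 ↔ i + N ≤ j)
  cases p <;> simp only [Pattern.Succeeds, ← not_le, hT]
  · have := hp rfl
    omega
  · omega
  · omega
  · rename_i s
    by_cases h : j + 1 = i + N
    · have := ha i (by omega)
      rw [h, ← this]
      tauto
    · omega

theorem four_le_length [DecidableEq K] {u : List (Sym K G × Sym K G)}
    (h : Path (RowEdge M x) (.inl .start) u (.inl .acc)) : 4 ≤ u.length := by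
  cases h with
  | cons he h =>
    cases he
    obtain ⟨b, v, rfl, -⟩ := RowEdge.count_sound h
    simp [StackMachine.cells]
    omega

variable [DecidableEq K] [Finite K] [Finite G] [Finite Q]

variable (M x) in
/-- The model satisfies the specification if and only if some accepted word of the row automaton
reads with a constant delay what it wrote. -/
theorem syncModels_iff_rowAccepts :
    SyncModels (model M x).language (spec (Nat.card (Sym K G))) ↔ M.RowAccepts x := by
  rw [syncModels_spec_iff (L := fun w => IsRow M x w ∨ IsMarking K G Q w)
    fun _ => mem_model_language]
  constructor
  · rintro ⟨m, α, τ, hτ, hα, h⟩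
    -- The first trace is also a possible second trace. Every test demands the proposition `0` in a
    -- letter of the first trace, and no mark contains it, so the first trace is not a word of
    -- marks.
    have hrow : IsRow M x ((List.range m).map α) := by
      refine hα.resolve_right ?_
      rintro ⟨b, -, hb⟩
      obtain ⟨i, hi, hi0⟩ : ∃ i < m, 0 ∈ α i := by
        obtain ⟨-, i, hi, h | h | h⟩ := h α hα
        · exact ⟨i, hi, by simpa using h.1⟩
        · exact ⟨i, hi, h.1.1⟩
        · exact ⟨i, hi, h.1.1⟩
      have hmem : α i ∈ (List.range m).map α := List.mem_map_of_mem (List.mem_range.2 hi)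
      rw [hb, List.mem_map] at hmem
      obtain ⟨μ, -, hμ⟩ := hmem
      rw [← hμ, List.mem_toFinset] at hi0
      exact zero_notMem_props μ hi0
    obtain ⟨u, hu, hαu⟩ := hrow
    have : Inhabited (Sym K G × Sym K G) := ⟨(.hash, .hash)⟩
    obtain ⟨a, ha⟩ := List.exists_eq_map_range u
    have hm : m = u.length := by simpa using congrArg List.length hαu
    have h4 := four_le_length hu
    rw [← hm] at ha h4
    subst ha
    have hαa : ∀ i < m, α i = (rowProps (a i)).toFinset := by
      intro i hi
      rw [List.map_map] at hαu
      exact List.map_inj_left.1 hαu i (List.mem_range.2 hi)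
    have hmark : ∀ μ : ℕ → Mark K G, (Path (MarkEdge (Q := Q)) .start ((List.range m).map μ) .acc ∨
        Path (MarkEdge (Q := Q)) .start ((List.range m).map μ) .fin) → MarkPasses m a μ τ := by
      intro μ hμ
      refine (indexPasses_iff_markPasses hαa fun i _ => rfl).1
        (h (fun i => (μ i).props.toFinset) (.inr ⟨_, hμ, ?_⟩)).2
      rw [List.map_map]
      rfl
    refine ⟨_, hu, ?_⟩
    simp only [map_fst_drop_prefix_iff, List.length_map, List.length_range]
    refine delay_of_succeeds hτ h4 (fun p i j hij hj hp => ?_) ?_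
    · exact (Pattern.markPasses_place hτ hij hj).1 (hmark _ (.inr (p.path_place hij hj hp)))
    · exact (markPasses_wholeMarks (by omega)).1 (hmark _ (.inl (path_wholeMarks (by omega))))
  · rintro ⟨u, hu, N, hN, hNu, hpre⟩
    have : Inhabited (Sym K G × Sym K G) := ⟨(.hash, .hash)⟩
    obtain ⟨a, ha⟩ := List.exists_eq_map_range u
    generalize u.length = m at ha hNu
    subst ha
    rw [map_fst_drop_prefix_iff] at hpre
    have hN0 : (0 : ℝ≥0) < N := by exact_mod_cast (by omega : 0 < N)
    have hτ : ∀ i j : ℕ, i < j → j < m → ((i : ℝ≥0) + 1) / N < (j + 1) / N := by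
      intro i j hij _
      rw [div_lt_div_iff_of_pos_right hN0]
      exact_mod_cast (by omega : i + 1 < j + 1)
    refine ⟨m, fun i => (rowProps (a i)).toFinset, fun k => (k + 1) / N, hτ,
      .inl ⟨_, hu, by rw [List.map_map]; rfl⟩, fun β hβ => ⟨fun i _ => by positivity, ?_⟩⟩
    rcases hβ with ⟨v, hv, hβv⟩ | ⟨b, hb, hβb⟩
    -- If the second trace is itself a computation, the test succeeds at the first event, where both
    -- letters contain `0`.
    · have hm : 0 < m := by omega
      have h0 : 0 ∈ β 0 := by
        have hmem : β 0 ∈ (List.range m).map β := List.mem_map_of_mem (List.mem_range.2 hm)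
        rw [hβv, List.mem_map] at hmem
        obtain ⟨c, -, hc⟩ := hmem
        simp [← hc, rowProps]
      exact ⟨0, hm, .inl ⟨by simp [rowProps], .inl (by simpa using h0)⟩⟩
    · have key : ∀ μ : ℕ → Mark K G, b = (List.range m).map μ →
          MarkPasses m a μ (fun k => (k + 1) / N) → IndexPasses (Nat.card (Sym K G)) m
            (fun i => (rowProps (a i)).toFinset) β (fun k => (k + 1) / N) := by
        rintro μ rfl h
        refine (indexPasses_iff_markPasses (fun _ _ => rfl) fun i hi => ?_).2 h
        rw [List.map_map] at hβb
        exact List.map_inj_left.1 hβb i (List.mem_range.2 hi)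
      have hmb : m = b.length := by simpa using congrArg List.length hβb
      rcases marks_start hb with ⟨c, rfl⟩ | ⟨p, c, d, l, rfl, hd⟩
      · rw [wholeMarks_eq_map] at key hmb
        obtain rfl : m = c + 2 := by simpa using hmb
        refine key _ rfl ((markPasses_wholeMarks (by omega)).2 ?_)
        rw [div_add_one hN0.ne', div_le_div_iff_of_pos_right hN0]
        exact_mod_cast (by omega : 0 + 1 + N ≤ c + 1 + 1)
      · rw [marks_eq_map_place] at key hmb
        obtain rfl : m = c + (d + (l + 2) + 2) := by simpa using hmb
        exact key _ rfl ((Pattern.markPasses_place hτ (by omega) (by omega)).2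
          (succeeds_of_delay hN hpre (by omega) fun hp => by rw [hd hp]))

end Equivalence

/-! ### The reduction is computable -/

theorem primrec_code_transition {f g : ℕ → ℕ} (hf : Primrec f) (l : List ℕ) (hg : Primrec g) :
    Primrec fun k => Transition.code (⟨f k, l, [], [], g k⟩ : Transition ℕ) := by
  have h : Primrec fun k => (f k, l, ([] : List ℕ), ([] : List ℕ), g k) :=
    .pair hf (.pair (.const _) (.pair (.const _) (.pair (.const _) hg)))
  exact Primrec.encode.comp h

theorem primrec_code_instance {A : ℕ → TA ℕ} {φ : Formula} (n : ℕ)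
    (hlocs : Primrec fun x => (A x).locs) (i c : ℕ)
    (htrans : Primrec fun x => (A x).trans.map Transition.code)
    (acc : List ℕ) (hA : ∀ x, (A x).init = i ∧ (A x).clocks = c ∧ (A x).acc = acc) :
    Primrec fun x => Instance.code ⟨n, A x, φ⟩ := by
  have h : Primrec fun x => ((A x).locs, i, c, (A x).trans.map Transition.code, acc) :=
    .pair hlocs (.pair (.const _) (.pair (.const _) (.pair htrans (.const _))))
  have h' : Primrec fun x => (A x).code :=
    (Primrec.encode.comp h).of_eq fun x => by
      obtain ⟨h₁, h₂, h₃⟩ := hA x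
      rw [TA.code, h₁, h₂, h₃]
  have h'' : Primrec fun x => (n, (A x).code, φ.code) := .pair (.const _) (.pair h' (.const _))
  exact Primrec.encode.comp h''

section Reduction

variable {K G Q : Type} [DecidableEq K] [Finite K] [Finite G] [Finite Q]

/-- The instance that asks whether `M` halts on the input `x`. -/
noncomputable def haltingInstance (M : StackMachine K G Q) (x : ℕ) : Instance :=
  ⟨numProps K G, model M x, spec (Nat.card (Sym K G))⟩

theorem haltingInstance_valid (M : StackMachine K G Q) (x : ℕ) : (haltingInstance M x).Valid :=
  ⟨model_wellFormed, rfl, spec_closedOver _⟩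

theorem haltingInstance_holds (M : StackMachine K G Q) (x : ℕ) :
    (haltingInstance M x).Holds ↔ Instr.Halts M.prog M.q₀ (M.input x) :=
  (syncModels_iff_rowAccepts M x).trans StackMachine.rowAccepts_iff_halts

theorem haltingInstance_translates (M : StackMachine K G Q) (x : ℕ) :
    TranslatesInto (haltingInstance M x).n (haltingInstance M x).spec (mia (Nat.card (Sym K G))) :=
  spec_translatesInto _

/-- All finite data are fixed with the machine. The input enters only through the number of
locations, the edge into the counter `x` and a list mapped over `List.range x`; counters are
numbered after the fixed locations, so their numbers are affine in the counter and the code is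
primitive recursive. -/
theorem computable_code_haltingInstance (M : StackMachine K G Q) :
    Computable fun x => (haltingInstance M x).code := by
  have hloc : Primrec fun k : ℕ => locNum (K := K) (G := G) (Q := Q) (.inr k) :=
    Primrec.nat_add.comp (.const _) .id
  have henter : Primrec fun x : ℕ => Transition.code (edgeTrans (K := K) (G := G) (Q := Q)
      (.inl .start) (.inl (.hash, .first)) (.inr x)) :=
    primrec_code_transition (.const _) _ hloc
  have hcount : Primrec fun k : ℕ => Transition.code (edgeTrans (K := K) (G := G) (Q := Q)
      (.inr (k + 1)) (.inl (.hash, .cell (M.single M.z))) (.inr k)) :=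
    primrec_code_transition (hloc.comp .succ) _ hloc
  have htrans : Primrec fun x => (model M x).trans.map Transition.code := by
    refine (Primrec.list_append.comp (.const ((fixedTrans M).map Transition.code))
      (Primrec.list_cons.comp henter
        (Primrec.list_map Primrec.list_range (hcount.comp .snd).to₂))).of_eq fun x => ?_
    simp only [model, List.map_append, List.map_cons, List.map_map]
    rfl
  exact (primrec_code_instance _ (Primrec.nat_add.comp (.const _) .succ) _ _ htrans _
    fun _ => ⟨rfl, rfl, rfl⟩).to_comp

end Reduction

/-- A partial procedure composed with a computable reduction into `S` is total, so undecidability is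
inherited even though nothing is required outside `S`. -/
theorem DecidableOn.computablePred {ι : Type} {code : ι → ℕ} {S : Set ι} {P : ι → Prop}
    (h : DecidableOn code S P) {r : ℕ → ι} (hr : Computable fun x => code (r x))
    (hS : ∀ x, r x ∈ S) : ComputablePred fun x => P (r x) := by
  classical
  obtain ⟨f, hf, hfS⟩ := h
  refine ComputablePred.computable_iff.2 ⟨fun x => decide (P (r x)), ?_, by simp⟩
  exact (hf.comp hr).of_eq fun x => hfS _ (hS x)

end HyperMTL

/-! ### The undecidability theorem -/

theorem mainTheorem8 :
    -- untimed model, `∃*∀*` specification whose quantifier-free part translates into an MIA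
    (¬ HyperMTL.DecidableOn HyperMTL.Instance.code
      {i | i.Valid ∧ i.spec.IsExistsForall ∧ ∃ B, HyperMTL.TranslatesInto i.n i.spec B}
      HyperMTL.Instance.Holds) ∧
    -- already for `∃∀∀` specifications
    (¬ HyperMTL.DecidableOn HyperMTL.Instance.code
      {i | i.Valid ∧ i.spec.IsExistsForallForall ∧ ∃ B, HyperMTL.TranslatesInto i.n i.spec B}
      HyperMTL.Instance.Holds) ∧
    -- even if such an MIA is given as part of the input
    (¬ HyperMTL.DecidableOn
      (fun j : HyperMTL.Instance × HyperMTL.TA (ℕ × ℕ) => Nat.pair j.1.code j.2.code)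
      {j | j.1.Valid ∧ j.1.spec.IsExistsForallForall ∧
        HyperMTL.TranslatesInto j.1.n j.1.spec j.2}
      (fun j => j.1.Holds)) := by
  open HyperMTL in
  obtain ⟨K, G, Q, _, _, _, _, prog, q₀, k₀, z, t₁, t₂, hM⟩ := exists_stackMachine_not_computable
  let M : StackMachine K G Q := ⟨prog, q₀, k₀, z, t₁, t₂⟩
  have hcode := computable_code_haltingInstance M
  have hundec : ¬ ComputablePred fun x => (haltingInstance M x).Holds := by
    simp only [haltingInstance_holds]
    exact hM
  have hpat : ∀ x, (haltingInstance M x).spec.IsExistsForallForall := fun x => ⟨_, _, _, _, rfl⟩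
  refine ⟨fun h => hundec ?_, fun h => hundec ?_, fun h => hundec ?_⟩
  · exact h.computablePred hcode fun x =>
      ⟨haltingInstance_valid M x, trivial, _, haltingInstance_translates M x⟩
  · exact h.computablePred hcode fun x =>
      ⟨haltingInstance_valid M x, hpat x, _, haltingInstance_translates M x⟩
  -- This automaton depends on the machine but not on the input `x`, so its code enters the
  -- reduction as a constant.
  · let B := mia (Nat.card (Sym K G))
    have hpair (c : ℕ) : Computable fun x => Nat.pair (haltingInstance M x).code c :=
      Primrec₂.natPair.to_comp.comp hcode (.const c)
    refine h.computablePred (r := fun x => (haltingInstance M x, B)) ?_ fun x =>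
      ⟨haltingInstance_valid M x, hpat x, haltingInstance_translates M x⟩
    exact hpair B.code
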